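/- Multigraphs below are finite and undirected, and may have parallel edges and self-loops. For a multigraph $H$ on a vertex set $V$ with $|V|=n\ge 2$ let $\phi(H)=\min\{|E_H(S,\bar S)|/|S| : S\subset V,\ 0<|S|\le n/2\}$, where edges are counted with multiplicity; $H$ is an edge-expander if $\phi(H)>\frac13$. A bisection of $V$ is a partition $(S,\bar S)$ into parts of sizes $\lfloor n/2\rfloor$ and $\lceil n/2\rceil$. An $r$-regular weave on $(S,\bar S)$ is an $r$-regular multigraph on $V$ in which every vertex has an incident edge that crosses $(S,\bar S)$. The Cut-Weave game with parameter $r\ge1$ on $V=\{0,\dots,n-1\}$ starts with the graph $H$ on $V$ without edges. In each round the cut player chooses a bisection, the weave player answers with an $r$-regular weave on it, and the edges of the weave are added to $H$ (keeping parallel edges). The cut player wins when $H$ is an edge-expander. Theorem. There are a randomized strategy of the cut player, given by a single algorithm for all $n$, $r$ and all rounds, and an absolute constant $C>0$ with the following properties. (1) Efficiency. In each round the algorithm receives $n$, $r$, the weaves $H_1,\dots,H_t$ played so far and $\mathrm{poly}(n,r)$ fresh uniformly random bits, always outputs a bisection, and runs in time polynomial in $n+r+t$ (bit operations on a random access machine),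 whatever the random bits are. (2) Form. Let $M_s$ be the transition matrix of the lazy random walk on $H_s$ (stay with probability $\frac12$, follow each incident edge with probability $\frac1{2r}$). In each round the algorithm draws from the fresh random bits a vector $z\in\mathbb R^n$ with $z\perp\mathbf 1$ and $\mathbb E\langle x,z\rangle^2=\|x\|_2^2$ for all $x\perp\mathbf 1$, and outputs a bisection $(S,\bar S)$ in which $S$ consists of $\lfloor n/2\rfloor$ vertices with the smallest entries of $M_tM_{t-1}\cdots M_1z$. (3) Number of rounds. For all $n\ge2$ and $r,k\ge1$, for every strategy of the weave player (whose answers may depend on all bisections so far), and for every integer $T\ge C\,k\,r\log^2 n$, with probability at least $1-n^{-k}$ the graph $H$ after $T$ rounds is an edge-expander and satisfies $\phi(H)\ge\frac12 r$. In particular, the cut player wins within $O(r\log^2n)$ rounds with high probability. -/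

import Mathlib

namespace CutWeave

/-! ### Multigraphs, expansion, bisections, weaves -/

/-- A finite undirected multigraph on `n` labelled vertices, parallel edges and self-loops allowed:
`adj v w` is the number of edges between `v` and `w` for `v ≠ w`, and `adj v v` is the number of
edge ends that the self-loops at `v` contribute to the degree of `v` (any value is allowed, so it
does not matter whether a loop is counted once or twice). -/
structure Multigraph (n : ℕ) where
  adj : Fin n → Fin n → ℕ
  symm : ∀ v w, adj v w = adj w v

variable {n : ℕ}

/-- Every vertex has degree `r`. -/
def Multigraph.IsRegular (G : Multigraph n) (r : ℕ) : Prop :=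
  ∀ v, ∑ w, G.adj v w = r

/-- The sum of multigraphs: edge multiplicities add up. The empty sum has no edges. -/
def Multigraph.sum (l : List (Multigraph n)) : Multigraph n where
  adj v w := (l.map fun G => G.adj v w).sum
  symm v w := by simp only [fun G : Multigraph n => G.symm v w]

/-- The number of edges with exactly one endpoint in `S`. -/
def Multigraph.cutSize (G : Multigraph n) (S : Finset (Fin n)) : ℕ :=
  ∑ v ∈ S, ∑ w ∈ Sᶜ, G.adj v w

/-- The edge-expansion `φ(G)`, the minimum of `|E(S, Sᶜ)| / |S|` over `0 < |S| ≤ n / 2`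
(there is such an `S` as soon as `2 ≤ n`). -/
noncomputable def Multigraph.expansion (G : Multigraph n) : ℝ :=
  ⨅ S : {S : Finset (Fin n) // S.Nonempty ∧ 2 * S.card ≤ n},
    (G.cutSize S.1 : ℝ) / (S.1.card : ℝ)

/-- The cut player wins as soon as the graph is an edge-expander. -/
def Multigraph.IsEdgeExpander (G : Multigraph n) : Prop :=
  1 / 3 < G.expansion

/-- `(S, Sᶜ)` is a bisection: the two sides have sizes `⌊n / 2⌋` and `⌈n / 2⌉`. -/
def IsBisection (S : Finset (Fin n)) : Prop :=
  S.card = n / 2 ∨ Sᶜ.card = n / 2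

/-- `G` is an `r`-regular weave on `(S, Sᶜ)`: every vertex has an incident edge that crosses. -/
def IsWeave (r : ℕ) (S : Finset (Fin n)) (G : Multigraph n) : Prop :=
  G.IsRegular r ∧ ∀ v, ∃ w, (v ∈ S ↔ w ∉ S) ∧ 0 < G.adj v w

/-! ### A random access machine with logarithmic cost

Programs compute with natural numbers that are stored in arrays; the value `σ a i` is the content
of cell `i` of array `a`, and the scalar variable `x` is cell `0` of array `x`. Every operation is
charged for the number of bits of the numbers it handles, and there is no multiplication. The only
loops are counting loops, so every program halts; polynomial time is not affected by this
restriction. -/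

/-- Memory contents. -/
abbrev Store : Type := ℕ → ℕ → ℕ

/-- Write `x` into cell `i` of array `a`. -/
def Store.set (σ : Store) (a i x : ℕ) : Store :=
  Function.update σ a (Function.update (σ a) i x)

/-- Expressions. -/
inductive Expr : Type
  | lit (c : ℕ)
  | get (a : ℕ) (i : Expr)
  | add (e f : Expr)
  | sub (e f : Expr)
  | lt (e f : Expr)

/-- The value of an expression: `get` reads a cell with a computed address, `sub` is truncated
subtraction, and `lt` is `1` or `0`. -/
def Expr.eval (σ : Store) : Expr → ℕ
  | .lit c => c
  | .get a i => σ a (i.eval σ)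
  | .add e f => e.eval σ + f.eval σ
  | .sub e f => e.eval σ - f.eval σ
  | .lt e f => if e.eval σ < f.eval σ then 1 else 0

/-- The time to evaluate an expression: one unit for every operation, and one for every bit of
every intermediate value (including the addresses). -/
def Expr.time (σ : Store) : Expr → ℕ
  | .lit c => 1 + Nat.size c
  | .get a i => i.time σ + 1 + Nat.size (σ a (i.eval σ))
  | .add e f => e.time σ + f.time σ + 1 + Nat.size (e.eval σ + f.eval σ)
  | .sub e f => e.time σ + f.time σ + 1 + Nat.size (e.eval σ - f.eval σ)
  | .lt e f => e.time σ + f.time σ + 2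

/-- Programs. -/
inductive Prog : Type
  | skip
  | assign (a : ℕ) (i e : Expr)
  | seq (p q : Prog)
  | ite (e : Expr) (p q : Prog)
  | loop (x : ℕ) (e : Expr) (p : Prog)

/-- The store after `k` rounds of a counting loop whose body acts by `f`; before the round with
number `j` (counted from `0`) the scalar `x` is set to `j`. -/
def loopStore (f : Store → Store) (x : ℕ) (σ : Store) : ℕ → Store
  | 0 => σ
  | k + 1 => f ((loopStore f x σ k).set x 0 k)

/-- The effect of a program: `assign a i e` is `a[i] := e`; `ite e p q` runs `p` if `e` is nonzero
and `q` otherwise; `loop x e p` evaluates `e` once and then runs `p` that many times. -/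
def Prog.exec : Prog → Store → Store
  | .skip, σ => σ
  | .assign a i e, σ => σ.set a (i.eval σ) (e.eval σ)
  | .seq p q, σ => q.exec (p.exec σ)
  | .ite e p q, σ => if e.eval σ ≠ 0 then p.exec σ else q.exec σ
  | .loop x e p, σ => loopStore p.exec x σ (e.eval σ)

/-- The running time of a program. -/
def Prog.time : Prog → Store → ℕ
  | .skip, _ => 1
  | .assign _ i e, σ => 1 + i.time σ + e.time σ
  | .seq p q, σ => 1 + p.time σ + q.time (p.exec σ)
  | .ite e p q, σ => 1 + e.time σ + (if e.eval σ ≠ 0 then p.time σ else q.time σ)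
  | .loop x e p, σ => 1 + e.time σ + ∑ k ∈ Finset.range (e.eval σ),
      (1 + Nat.size k + p.time ((loopStore p.exec x σ k).set x 0 k))

/-! ### Randomized strategies of the cut player -/

/-- The number `adj i j` of the graph number `s` in a list, `0` out of range. -/
def entry (hist : List (Multigraph n)) (s i j : ℕ) : ℕ :=
  if h : i < n ∧ j < n then
    match hist[s]? with
    | some G => G.adj ⟨i, h.1⟩ ⟨j, h.2⟩
    | none => 0
  else 0

/-- The input of the cut player's program: array `0` holds `n`, `r` and the number of weaves played
so far, array `1` holds their adjacency matrices one after the other, row by row, and array `2`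
holds the random bits of this round; everything else is `0`. -/
def input (r : ℕ) (hist : List (Multigraph n)) {m : ℕ} (ρ : Fin m → Bool) : Store :=
  fun a p =>
    match a with
    | 0 => if p = 0 then n else if p = 1 then r else if p = 2 then hist.length else 0
    | 1 => entry hist (p / (n * n)) (p / n % n) (p % n)
    | 2 => if h : p < m then (ρ ⟨p, h⟩).toNat else 0
    | _ => 0

/-- A randomized strategy of the cut player: one program, used for all `n` and `r` and in all
rounds, which in every round gets `coins (n + r)` fresh uniformly random bits. -/
structure CutStrategy where
  prog : Prog
  coins : Polynomial ℕ

/-- The random bits of one round. -/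
abbrev CutStrategy.Coins (A : CutStrategy) (n r : ℕ) : Type :=
  Fin (A.coins.eval (n + r)) → Bool

/-- The side `S` that the cut player chooses after the weaves `hist`, with random bits `ρ`: the
vertices `v` with a nonzero entry `v` in array `3` when the program halts. -/
def CutStrategy.cut (A : CutStrategy) (r : ℕ) (hist : List (Multigraph n)) (ρ : A.Coins n r) :
    Finset (Fin n) :=
  Finset.univ.filter fun v => A.prog.exec (input r hist ρ) 3 v ≠ 0

/-- The strategy always plays a bisection. -/
def CutStrategy.IsValid (A : CutStrategy) : Prop :=
  ∀ (n r : ℕ) (hist : List (Multigraph n)), (∀ G ∈ hist, G.IsRegular r) →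
    ∀ ρ : A.Coins n r, IsBisection (A.cut r hist ρ)

/-- The time for every round is polynomial in `n`, `r` and the number of rounds played so far,
for all outcomes of the random bits. -/
def CutStrategy.IsPolyTime (A : CutStrategy) : Prop :=
  ∃ P : Polynomial ℕ, ∀ (n r : ℕ) (hist : List (Multigraph n)), (∀ G ∈ hist, G.IsRegular r) →
    ∀ ρ : A.Coins n r, A.prog.time (input r hist ρ) ≤ P.eval (n + r + hist.length)

/-- One step of the lazy random walk on an `r`-regular multigraph: stay with probability `1 / 2`,
and otherwise follow one of the `r` incident edge ends. -/
noncomputable def lazyWalk (r : ℕ) (G : Multigraph n) : Matrix (Fin n) (Fin n) ℝ :=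
  fun v w => (if v = w then 1 / 2 else 0) + (G.adj v w : ℝ) / (2 * (r : ℝ))

/-- The walk `M_t ⋯ M_2 M_1` that takes one lazy step on each graph of the list, in order. -/
noncomputable def walk (r : ℕ) (hist : List (Multigraph n)) : Matrix (Fin n) (Fin n) ℝ :=
  hist.foldl (fun P G => lazyWalk r G * P) 1

/-- The strategy is a random projection of the lazy random walk: in each round it draws, from the
fresh random bits alone, a vector `z ⊥ 1` which is isotropic on the complement of the all-ones
vector, and puts into `S` the `⌊n / 2⌋` vertices with the smallest entries of `M_t ⋯ M_1 z`. -/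
def CutStrategy.IsWalkProjection (A : CutStrategy) : Prop :=
  ∀ n r : ℕ, 1 ≤ r → ∃ z : A.Coins n r → Fin n → ℝ,
    (∀ ρ, ∑ v, z ρ v = 0) ∧
    (∀ x : Fin n → ℝ, ∑ v, x v = 0 →
      (∑ ρ, (∑ v, x v * z ρ v) ^ 2) / (Fintype.card (A.Coins n r) : ℝ) = ∑ v, x v ^ 2) ∧
    ∀ hist : List (Multigraph n), (∀ G ∈ hist, G.IsRegular r) → ∀ ρ,
      (A.cut r hist ρ).card = n / 2 ∧
      ∀ v ∈ A.cut r hist ρ, ∀ w ∉ A.cut r hist ρ,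
        (walk r hist).mulVec (z ρ) v ≤ (walk r hist).mulVec (z ρ) w

/-! ### The game -/

/-- A strategy of the weave player: the answer to the bisection `S` after the bisections `past`
(oldest first; the earlier weaves are determined by them and by the strategy). -/
abbrev WeaveStrategy (n : ℕ) : Type :=
  (past : List (Finset (Fin n))) → (S : Finset (Fin n)) → Multigraph n

/-- The weave player always answers a bisection with an `r`-regular weave on it. -/
def WeaveStrategy.IsLegal (W : WeaveStrategy n) (r : ℕ) : Prop :=
  ∀ past S, IsBisection S → IsWeave r S (W past S)

/-- The bisections and the weaves played, oldest first, when the cut player uses `A` with the given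
random bits (one entry of the list for each round) and the weave player uses `W`. -/
def play (A : CutStrategy) (r : ℕ) (W : WeaveStrategy n) (bits : List (A.Coins n r)) :
    List (Finset (Fin n)) × List (Multigraph n) :=
  bits.foldl
    (fun h ρ => (h.1 ++ [A.cut r h.2 ρ], h.2 ++ [W h.1 (A.cut r h.2 ρ)])) ([], [])

/-- The graph `H` after `T` rounds, the sum of the weaves. -/
def finalGraph (A : CutStrategy) (r : ℕ) (W : WeaveStrategy n) {T : ℕ}
    (ω : Fin T → A.Coins n r) : Multigraph n :=
  Multigraph.sum (play A r W (List.ofFn ω)).2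

/-- The probability of the event `E` under the uniform distribution on a finite type. -/
noncomputable def uniformProb {α : Type} [Fintype α] (E : Set α) : ℝ :=
  (E.ncard : ℝ) / (Fintype.card α : ℝ)

end CutWeave

/-! Let `P` be the product of the lazy walk matrices so far. The potential Φ is the squared
Frobenius distance of `P` from the matrix with all entries `1 / n`. A lazy step is a contraction
with a quantified loss: a new weave lowers Φ by at least `1 / (4 * r)` times the sum, over ordered
adjacent pairs with multiplicity, of the squared distances between rows of `P`
(`potential_append_le`).

The cut player sees these distances through a random projection. Let `u v` be the inner product of
row `v` of the deviation matrix with random signs. Then `u` sums to zero and its squared norm has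
expectation Φ. The chosen side holds the smallest entries of `u`, so every crossing edge straddles a
common threshold. Every vertex has such an edge, hence the Dirichlet form of `u` on the weave is at
least the squared norm of `u` (`IsWeave.sum_sq_le`). By the sub-Gaussian tail of sign sums
(`card_coins_tail_le`) and a union bound over pairs, projected squared distances exceed the true
ones by a factor of at most `10 * log n`, outside an event of probability at most `2 / n ^ 3`. On
that event the crude bound nΦ for the squared norm suffices. Thus Φ shrinks in expectation by the
factor `1 - 1 / (80 * r * log n)` per round, whatever the weave player does
(`sum_potential_append_le`).

Iteration and Markov's inequality make Φ at most `1 / (4 * n ^ 2)` with the required probability.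
Then all entries of `P` are at least `1 / (2 * n)`, so much mass has moved across every cut. Each
edge across a cut carries at most `1 / (2 * r)`, so every cut has many edges
(`expansion_of_potential_le`).

For efficiency the walk is scaled by `2 * r` per step and runs on natural numbers. Polynomial time
follows from a syntactic criterion: loop lengths are read from input cells that are never
overwritten (`CutStrategy.isPolyTime_of_tame`). -/

namespace CutWeave

/-! ### Polynomial running time of programs with bounded loops -/

/-- An upper bound for the number of operations in an expression and for its literals. -/
def Expr.weight : Expr → ℕ
  | .lit c => 1 + c
  | .get _ i => i.weight + 1
  | .add e f => e.weight + f.weight + 1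
  | .sub e f => e.weight + f.weight + 1
  | .lt e f => e.weight + f.weight + 2

/-- All numbers in memory have at most `b` bits. -/
def Store.BitBound (σ : Store) (b : ℕ) : Prop :=
  ∀ a i, Nat.size (σ a i) ≤ b

theorem Store.BitBound.mono {σ : Store} {b c : ℕ} (h : σ.BitBound b) (hbc : b ≤ c) :
    σ.BitBound c := fun a i => (h a i).trans hbc

theorem Store.set_apply (σ : Store) (a i x a' i' : ℕ) :
    σ.set a i x a' i' = if a' = a ∧ i' = i then x else σ a' i' := by
  unfold Store.set
  by_cases ha : a' = a
  · subst ha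
    by_cases hi : i' = i
    · subst hi; simp
    · simp [hi]
  · simp [ha]

theorem Store.set_of_ne (σ : Store) (a i x : ℕ) {a' : ℕ} (h : a' ≠ a) :
    σ.set a i x a' = σ a' := by
  unfold Store.set
  simp [h]

theorem Store.BitBound.set {σ : Store} {b : ℕ} (h : σ.BitBound b) (a i : ℕ) {x : ℕ}
    (hx : Nat.size x ≤ b) : (σ.set a i x).BitBound b := by
  intro a' i'
  rw [Store.set_apply]
  split_ifs
  · exact hx
  · exact h a' i'

theorem size_le_self (m : ℕ) : Nat.size m ≤ m :=
  Nat.size_le.2 m.lt_two_pow_self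

theorem size_add_le {x y b : ℕ} (hx : Nat.size x ≤ b) (hy : Nat.size y ≤ b) :
    Nat.size (x + y) ≤ b + 1 := by
  rw [Nat.size_le] at *
  rw [pow_succ]
  omega

theorem Expr.size_eval_le {σ : Store} {b : ℕ} (h : σ.BitBound b) (e : Expr) :
    Nat.size (e.eval σ) ≤ b + e.weight := by
  induction e with
  | lit c => simp only [Expr.eval, Expr.weight]; have := size_le_self c; omega
  | get a i _ => exact (h _ _).trans (Nat.le_add_right _ _)
  | add e f he hf =>
    simp only [Expr.eval, Expr.weight]
    exact (size_add_le (b := b + e.weight + f.weight) (by omega) (by omega)).trans (by omega)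
  | sub e f he hf =>
    simp only [Expr.eval, Expr.weight]
    exact (Nat.size_le_size (Nat.sub_le _ _)).trans (by omega)
  | lt e f he hf =>
    simp only [Expr.eval, Expr.weight]
    split_ifs
    · simp only [Nat.size_one]; omega
    · simp

theorem Expr.time_le {σ : Store} {b : ℕ} (h : σ.BitBound b) (e : Expr) :
    e.time σ ≤ e.weight * (1 + b + e.weight) := by
  induction e with
  | lit c => simp only [Expr.time, Expr.weight]; have := size_le_self c; nlinarith
  | get a i hi =>
    simp only [Expr.time, Expr.weight]
    have := h a (i.eval σ)
    nlinarith
  | add e f he hf =>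
    have := (Expr.add e f).size_eval_le h
    simp only [Expr.time, Expr.weight, Expr.eval] at *
    nlinarith [Nat.zero_le (e.weight * f.weight)]
  | sub e f he hf =>
    have := (Expr.sub e f).size_eval_le h
    simp only [Expr.time, Expr.weight, Expr.eval] at *
    nlinarith [Nat.zero_le (e.weight * f.weight)]
  | lt e f he hf =>
    simp only [Expr.time, Expr.weight] at *
    nlinarith [Nat.zero_le (e.weight * f.weight)]

/-- The program never writes to the arrays `0`, `1`, and the number of rounds of every loop is read
from one of them. -/
def Prog.Tame : Prog → Prop
  | .skip => True
  | .assign a _ _ => 2 ≤ a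
  | .seq p q => p.Tame ∧ q.Tame
  | .ite _ p q => p.Tame ∧ q.Tame
  | .loop x e p => 2 ≤ x ∧ (∃ a i, a < 2 ∧ e = .get a i) ∧ p.Tame

/-- The loop-invariant rule behind all correctness and size proofs below. The bound `K` lets the
invariant step use that the counter is smaller than the number of rounds. -/
theorem loopStore_induction {f : Store → Store} {x : ℕ} {σ : Store} {K : ℕ}
    (I : ℕ → Store → Prop) (h0 : I 0 σ)
    (hs : ∀ k < K, ∀ τ, I k τ → I (k + 1) (f (τ.set x 0 k))) :
    ∀ k ≤ K, I k (loopStore f x σ k) := by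
  intro k hk
  induction k with
  | zero => exact h0
  | succ k ih => exact hs k hk _ (ih (by omega))

theorem Prog.Tame.exec_apply {p : Prog} (hp : p.Tame) (σ : Store) {a : ℕ} (ha : a < 2) :
    p.exec σ a = σ a := by
  induction p generalizing σ with
  | skip => rfl
  | assign b i e =>
    simp only [Prog.Tame] at hp
    exact Store.set_of_ne _ _ _ _ (by omega)
  | seq p q ihp ihq => simp only [Prog.exec]; rw [ihq hp.2, ihp hp.1]
  | ite e p q ihp ihq =>
    simp only [Prog.exec]
    split_ifs
    · exact ihp hp.1 _
    · exact ihq hp.2 _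
  | loop x e p ih =>
    obtain ⟨hx, -, hp⟩ := hp
    refine loopStore_induction (fun _ τ => τ a = σ a) rfl (fun k _ τ hτ => ?_) _ le_rfl
    rw [ih hp, Store.set_of_ne _ _ _ _ (by omega), hτ]

open Polynomial in
/-- The number of bits by which the numbers in memory can grow. -/
noncomputable def Prog.growth : Prog → Polynomial ℕ
  | .skip => 0
  | .assign _ _ e => C e.weight
  | .seq p q => p.growth + q.growth
  | .ite _ p q => p.growth + q.growth
  | .loop _ _ p => X * p.growth

open Polynomial in
/-- A bound for the running time if all numbers have at most `B` bits throughout. -/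
noncomputable def Prog.cost (B : Polynomial ℕ) : Prog → Polynomial ℕ
  | .skip => 1
  | .assign _ i e => 1 + C i.weight * (1 + B + C i.weight) + C e.weight * (1 + B + C e.weight)
  | .seq p q => 1 + p.cost B + q.cost B
  | .ite e p q => 1 + C e.weight * (1 + B + C e.weight) + (p.cost B + q.cost B)
  | .loop _ e p => 1 + C e.weight * (1 + B + C e.weight) + X * (1 + X + p.cost B)

/-- An assignment adds only a constant number of bits to the largest number in memory, because there
is no multiplication. A loop repeats its body at most `N` times, since its length is an entry of a
read-only array. The counters stay below `N ≤ b`, so storing them costs no extra bits. -/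
theorem Prog.Tame.bitBound_exec {p : Prog} (hp : p.Tame) {N b : ℕ} (hN : N ≤ b) {σ : Store}
    (h01 : ∀ a < 2, ∀ i, σ a i ≤ N) (hσ : σ.BitBound b) :
    (p.exec σ).BitBound (b + p.growth.eval N) := by
  induction p generalizing σ b with
  | skip => simpa [Prog.exec, Prog.growth] using hσ
  | assign a i e =>
    simp only [Prog.exec, Prog.growth, Polynomial.eval_C]
    exact (hσ.mono (Nat.le_add_right _ _)).set _ _ (e.size_eval_le hσ)
  | seq p q ihp ihq =>
    simp only [Prog.exec, Prog.growth, Polynomial.eval_add, ← add_assoc]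
    refine ihq hp.2 (by omega) (fun a ha i => ?_) (ihp hp.1 hN h01 hσ)
    rw [hp.1.exec_apply σ ha]
    exact h01 a ha i
  | ite e p q ihp ihq =>
    simp only [Prog.exec, Prog.growth, Polynomial.eval_add]
    split_ifs
    · exact (ihp hp.1 hN h01 hσ).mono (by omega)
    · exact (ihq hp.2 hN h01 hσ).mono (by omega)
  | loop x e p ih =>
    obtain ⟨hx, ⟨a, i, ha, rfl⟩, hp⟩ := hp
    simp only [Prog.exec, Prog.growth, Polynomial.eval_mul, Polynomial.eval_X]
    have hK : (Expr.get a i).eval σ ≤ N := h01 a ha _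
    have key := loopStore_induction (f := p.exec) (x := x) (σ := σ) (K := (Expr.get a i).eval σ)
      (fun k τ => (∀ a < 2, τ a = σ a) ∧ τ.BitBound (b + k * p.growth.eval N))
      ⟨fun _ _ => rfl, by simpa using hσ⟩ ?_ _ le_rfl
    · exact key.2.mono (by gcongr)
    · rintro k hk τ ⟨h1, h2⟩
      have h1' : ∀ a < 2, τ.set x 0 k a = σ a := fun a ha => by
        rw [Store.set_of_ne _ _ _ _ (by omega), h1 a ha]
      refine ⟨fun a ha => by rw [hp.exec_apply _ ha, h1' a ha], ?_⟩
      have := ih hp (b := b + k * p.growth.eval N) (σ := τ.set x 0 k) (by omega)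
        (fun a ha i => by rw [h1' a ha]; exact h01 a ha i)
        (h2.set _ _ ((size_le_self k).trans (by omega)))
      exact this.mono (by rw [add_mul, one_mul, add_assoc])

theorem Prog.Tame.time_le {p : Prog} (hp : p.Tame) {B : Polynomial ℕ} {N b : ℕ} (hN : N ≤ b)
    {σ : Store} (h01 : ∀ a < 2, ∀ i, σ a i ≤ N) (hσ : σ.BitBound b)
    (hB : b + p.growth.eval N ≤ B.eval N) : p.time σ ≤ (p.cost B).eval N := by
  have expr_le : ∀ {τ : Store} {c : ℕ} (_ : τ.BitBound c) (_ : c ≤ B.eval N) (e : Expr),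
      e.time τ ≤ e.weight * (1 + B.eval N + e.weight) := fun h hc e =>
    (e.time_le h).trans (by gcongr)
  induction p generalizing σ b with
  | skip => simp [Prog.time, Prog.cost]
  | assign a i e =>
    have hb : b ≤ B.eval N := (Nat.le_add_right _ _).trans hB
    have h1 := expr_le hσ hb i
    have h2 := expr_le hσ hb e
    simp only [Prog.time, Prog.cost, Polynomial.eval_add, Polynomial.eval_mul, Polynomial.eval_C,
      Polynomial.eval_one]
    omega
  | seq p q ihp ihq =>
    simp only [Prog.growth, Polynomial.eval_add] at hB
    have h1 := ihp hp.1 hN h01 hσ (by omega)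
    have h2 := ihq hp.2 (b := b + p.growth.eval N) (by omega)
      (fun a ha i => by rw [hp.1.exec_apply σ ha]; exact h01 a ha i)
      (hp.1.bitBound_exec hN h01 hσ) (by omega)
    simp only [Prog.time, Prog.cost, Polynomial.eval_add, Polynomial.eval_one]
    omega
  | ite e p q ihp ihq =>
    simp only [Prog.growth, Polynomial.eval_add] at hB
    have h0 := expr_le hσ (by omega) e
    have h1 := ihp hp.1 hN h01 hσ (by omega)
    have h2 := ihq hp.2 hN h01 hσ (by omega)
    simp only [Prog.time, Prog.cost, Polynomial.eval_add, Polynomial.eval_mul, Polynomial.eval_C,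
      Polynomial.eval_one]
    split_ifs <;> omega
  | loop x e p ih =>
    have h0 := expr_le hσ (by omega) e
    obtain ⟨hx, ⟨a, i, ha, rfl⟩, hp⟩ := hp
    simp only [Prog.growth, Polynomial.eval_mul, Polynomial.eval_X] at hB
    have hK : (Expr.get a i).eval σ ≤ N := h01 a ha _
    have key := loopStore_induction (f := p.exec) (x := x) (σ := σ) (K := (Expr.get a i).eval σ)
      (fun k τ => (∀ a < 2, τ a = σ a) ∧ τ.BitBound (b + k * p.growth.eval N))
      ⟨fun _ _ => rfl, by simpa using hσ⟩ ?_
    · have hsum : ∑ k ∈ Finset.range ((Expr.get a i).eval σ),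
          (1 + Nat.size k + p.time ((loopStore p.exec x σ k).set x 0 k)) ≤
          ∑ k ∈ Finset.range ((Expr.get a i).eval σ), (1 + N + (p.cost B).eval N) := by
        refine Finset.sum_le_sum fun k hk => ?_
        rw [Finset.mem_range] at hk
        obtain ⟨h1, h2⟩ := key k hk.le
        have hsz := size_le_self k
        -- The growth of the `k` completed rounds together with that of the current one stays within
        -- the bit budget `B`, because `k + 1 ≤ N`.
        have hmul : (k + 1) * p.growth.eval N ≤ N * p.growth.eval N := by gcongr; omega
        rw [add_mul, one_mul] at hmul
        have := ih hp (b := b + k * p.growth.eval N) (by omega)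
          (σ := (loopStore p.exec x σ k).set x 0 k)
          (fun a ha i => by
            rw [Store.set_of_ne _ _ _ _ (by omega), h1 a ha]; exact h01 a ha i)
          (h2.set _ _ (by omega)) (by omega)
        omega
      rw [Finset.sum_const, Finset.card_range, smul_eq_mul] at hsum
      have hmul : (Expr.get a i).eval σ * (1 + N + (p.cost B).eval N) ≤
        N * (1 + N + (p.cost B).eval N) := by gcongr
      simp only [Prog.time, Prog.cost, Polynomial.eval_add, Polynomial.eval_mul, Polynomial.eval_C,
        Polynomial.eval_one, Polynomial.eval_X]
      omega
    · rintro k hk τ ⟨h1, h2⟩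
      have h1' : ∀ a < 2, τ.set x 0 k a = σ a := fun a ha => by
        rw [Store.set_of_ne _ _ _ _ (by omega), h1 a ha]
      refine ⟨fun a ha => by rw [hp.exec_apply _ ha, h1' a ha], ?_⟩
      have := hp.bitBound_exec (N := N) (b := b + k * p.growth.eval N) (σ := τ.set x 0 k)
        (by omega) (fun a ha i => by rw [h1' a ha]; exact h01 a ha i)
        (h2.set _ _ ((size_le_self k).trans (by omega)))
      exact this.mono (by rw [add_mul, one_mul, add_assoc])

theorem Multigraph.IsRegular.adj_le {n r : ℕ} {G : Multigraph n} (h : G.IsRegular r)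
    (v w : Fin n) : G.adj v w ≤ r := by
  rw [← h v]
  exact Finset.single_le_sum (f := fun w => G.adj v w) (fun _ _ => Nat.zero_le _)
    (Finset.mem_univ w)

theorem entry_le {n r : ℕ} {hist : List (Multigraph n)} (h : ∀ G ∈ hist, G.IsRegular r)
    (s i j : ℕ) : entry hist s i j ≤ r := by
  unfold entry
  split_ifs
  · split
    · rename_i G hG
      exact (h G (List.mem_of_getElem? hG)).adj_le _ _
    · exact Nat.zero_le _
  · exact Nat.zero_le _

/-- Regularity bounds all adjacency entries by `r`. The size parameter is `n + r + t + 1`, where the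
extra `1` covers the random bits even if the other terms vanish; hence the composition with `X + 1`.
-/
theorem CutStrategy.isPolyTime_of_tame {A : CutStrategy} (hA : A.prog.Tame) : A.IsPolyTime := by
  refine ⟨(A.prog.cost (Polynomial.X + A.prog.growth)).comp (Polynomial.X + 1),
    fun n r hist hreg ρ => ?_⟩
  have h01 : ∀ a < 2, ∀ i, input r hist ρ a i ≤ n + r + hist.length + 1 := by
    intro a ha i
    interval_cases a
    · simp only [input]
      split_ifs <;> omega
    · simp only [input]
      exact (entry_le hreg _ _ _).trans (by omega)
  have hb : (input r hist ρ).BitBound (n + r + hist.length + 1) := by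
    intro a i
    match a with
    | 0 => exact (size_le_self _).trans (h01 0 (by omega) i)
    | 1 => exact (size_le_self _).trans (h01 1 (by omega) i)
    | 2 =>
      refine (size_le_self _).trans ?_
      simp only [input]
      split_ifs
      · exact (Bool.toNat_le _).trans (by omega)
      · omega
    | a + 3 => simp [input]
  have := hA.time_le (B := Polynomial.X + A.prog.growth) le_rfl h01 hb (by simp)
  simpa using this

/-! ### The program of the cut player -/

/-- The value of a scalar variable. -/
abbrev Expr.var (x : ℕ) : Expr := .get x (.lit 0)

/-- `acc := acc + u[y]`, repeated `e` times, with `acc` in array `8` and `u` in array `4`. -/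
def addProg (e : Expr) (y : ℕ) : Prog :=
  .loop 11 e (.assign 8 (.lit 0) (.add (.var 8) (.get 4 (.var y))))

/-- The first `n` entries of array `b` are copied to array `a`. -/
def copyProg (a b : ℕ) : Prog :=
  .loop 6 (.var 0) (.assign a (.var 6) (.get b (.var 6)))

/-- Entry `v` (in array `6`) of the new vector, in array `5`; the scalar `9` runs through the
adjacency matrices. -/
def rowProg : Prog :=
  .seq (.assign 8 (.lit 0) (.lit 0)) <|
  .seq (.loop 7 (.var 0)
    (.seq (addProg (.get 1 (.var 9)) 7) (.assign 9 (.lit 0) (.add (.var 9) (.lit 1))))) <|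
  .seq (addProg (.get 0 (.lit 1)) 6) (.assign 5 (.var 6) (.var 8))

/-- One step of the walk, scaled by `2 * r`. -/
def stepProg : Prog :=
  .seq (.loop 6 (.var 0) rowProg) (copyProg 4 5)

/-- Array `3` marks the vertices with the `n / 2` smallest entries in array `4`. -/
def rankProg : Prog :=
  .loop 6 (.var 0) <|
  .seq (.assign 8 (.lit 0) (.lit 0)) <|
  .seq (.loop 7 (.var 0) (.assign 8 (.lit 0)
    (.add (.var 8) (.lt (.get 4 (.var 7)) (.add (.get 4 (.var 6)) (.lt (.var 7) (.var 6))))))) <|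
  .assign 3 (.var 6) (.lt (.add (.add (.var 8) (.var 8)) (.lit 1)) (.var 0))

/-- The program of the cut player: start with a random `0`-`1` vector, follow the walk, and choose
the smallest entries. -/
def cutProg : Prog :=
  .seq (copyProg 4 2) (.seq (.loop 10 (.get 0 (.lit 2)) stepProg) rankProg)

/-- The strategy of the cut player. -/
noncomputable def cutStrategy : CutStrategy where
  prog := cutProg
  coins := Polynomial.X

theorem cutStrategy_isPolyTime : cutStrategy.IsPolyTime := by
  apply CutStrategy.isPolyTime_of_tame
  simp [cutStrategy, cutProg, copyProg, stepProg, rowProg, addProg, rankProg, Prog.Tame]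

/-- Multiplication by repeated addition. The scalar `y` must differ from the accumulator and the
counter, which the loop overwrites. -/
theorem addProg_exec (e : Expr) {y : ℕ} (h8 : y ≠ 8) (h11 : y ≠ 11) (σ : Store) :
    (∀ a, a ≠ 8 → a ≠ 11 → (addProg e y).exec σ a = σ a) ∧
      (addProg e y).exec σ 8 0 = σ 8 0 + e.eval σ * σ 4 (σ y 0) := by
  refine loopStore_induction
    (fun k τ => (∀ a, a ≠ 8 → a ≠ 11 → τ a = σ a) ∧ τ 8 0 = σ 8 0 + k * σ 4 (σ y 0))
    ⟨fun _ _ _ => rfl, by simp⟩ ?_ _ le_rfl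
  rintro k - τ ⟨h1, h2⟩
  refine ⟨fun a ha ha' => ?_, ?_⟩
  · simp only [Prog.exec]
    rw [Store.set_of_ne _ _ _ _ ha, Store.set_of_ne _ _ _ _ ha', h1 a ha ha']
  · simp [Prog.exec, Expr.eval, Store.set_apply, h11, h1 4, h1 y h8 h11, h2]
    ring

theorem copyProg_exec {a b : ℕ} (ha : a ≠ 6) (hb : b ≠ 6) (hab : b ≠ a)
    (σ : Store) :
    (∀ c, c ≠ a → c ≠ 6 → (copyProg a b).exec σ c = σ c) ∧
      ∀ v < σ 0 0, (copyProg a b).exec σ a v = σ b v := by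
  refine loopStore_induction
    (fun k τ => (∀ c, c ≠ a → c ≠ 6 → τ c = σ c) ∧ ∀ v < k, τ a v = σ b v)
    ⟨fun _ _ _ => rfl, by simp⟩ ?_ _ le_rfl
  rintro k - τ ⟨h1, h2⟩
  refine ⟨fun c hc hc' => ?_, fun v hv => ?_⟩
  · simp only [Prog.exec]
    rw [Store.set_of_ne _ _ _ _ hc, Store.set_of_ne _ _ _ _ hc', h1 c hc hc']
  · simp only [Prog.exec, Expr.eval, Store.set_apply]
    by_cases hvk : v = k
    · simp [hvk, hb, h1 b hab hb]
    · simp [hvk, ha, h2 v (by omega)]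

theorem rowProg_exec (σ : Store) :
    (∀ a, a ≠ 5 → a ≠ 7 → a ≠ 8 → a ≠ 9 → a ≠ 11 → rowProg.exec σ a = σ a) ∧
      rowProg.exec σ 9 0 = σ 9 0 + σ 0 0 ∧
      ∀ v, rowProg.exec σ 5 v = if v = σ 6 0 then
        (∑ w ∈ Finset.range (σ 0 0), σ 1 (σ 9 0 + w) * σ 4 w) + σ 0 1 * σ 4 (σ 6 0) else σ 5 v := by
  have hloop := loopStore_induction (x := 7) (σ := σ.set 8 0 0) (K := σ 0 0)
    (f := (Prog.seq (addProg (.get 1 (.var 9)) 7)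
      (.assign 9 (.lit 0) (.add (.var 9) (.lit 1)))).exec)
    (fun k τ => (∀ a, a ≠ 7 → a ≠ 8 → a ≠ 9 → a ≠ 11 → τ a = σ a) ∧ τ 9 0 = σ 9 0 + k ∧
      τ 8 0 = ∑ w ∈ Finset.range k, σ 1 (σ 9 0 + w) * σ 4 w)
    ⟨fun a _ ha _ _ => Store.set_of_ne _ _ _ _ ha, by simp [Store.set_apply],
      by simp [Store.set_apply]⟩ ?_ _ le_rfl
  · obtain ⟨h1, h2, h3⟩ := hloop
    simp only [rowProg, Prog.exec, Expr.eval, Store.set_apply] at h1 h2 h3 ⊢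
    simp only [OfNat.zero_ne_ofNat, false_and, if_false]
    set τ := loopStore _ 7 (σ.set 8 0 0) (σ 0 0) with hτ
    obtain ⟨h4, h5⟩ := addProg_exec (.get 0 (.lit 1)) (y := 6) (by decide) (by decide) τ
    refine ⟨fun a h5 h7 h8 h9 h11 => ?_, ?_, fun v => ?_⟩
    · rw [Store.set_of_ne _ _ _ _ h5, h4 a h8 h11, h1 a h7 h8 h9 h11]
    · rw [if_neg (fun h => absurd h.1 (by decide)), h4 9 (by decide) (by decide), h2]
    · rw [h5, h4 6 (by decide) (by decide), h1 6 (by decide) (by decide) (by decide) (by decide),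
        h3, h4 5 (by decide) (by decide), h1 5 (by decide) (by decide) (by decide) (by decide),
        h1 4 (by decide) (by decide) (by decide) (by decide)]
      simp [Expr.eval, h1 0]
  · rintro k - τ ⟨h1, h2, h3⟩
    obtain ⟨h4, h5⟩ := addProg_exec (.get 1 (.var 9)) (y := 7) (by decide) (by decide)
      (τ.set 7 0 k)
    simp only [Prog.exec, Expr.eval]
    refine ⟨fun a h7 h8 h9 h11 => ?_, ?_, ?_⟩
    · rw [Store.set_of_ne _ _ _ _ h9, h4 a h8 h11, Store.set_of_ne _ _ _ _ h7, h1 a h7 h8 h9 h11]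
    · rw [h4 9 (by decide) (by decide)]
      simp [Store.set_apply, h2, add_assoc]
    · rw [Store.set_of_ne _ _ _ _ (by decide), h5, Finset.sum_range_succ]
      simp [Expr.eval, Store.set_apply, h2, h3, h1 1, h1 4]

/-- All rows are computed from the old vector into array `5` before it is copied back. The pointer
`9` advances by `n * n`, to the start of the next adjacency matrix. -/
theorem stepProg_exec (σ : Store) :
    (∀ a < 4, stepProg.exec σ a = σ a) ∧ stepProg.exec σ 9 0 = σ 9 0 + σ 0 0 * σ 0 0 ∧
      ∀ v < σ 0 0, stepProg.exec σ 4 v =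
        (∑ w ∈ Finset.range (σ 0 0), σ 1 (σ 9 0 + v * σ 0 0 + w) * σ 4 w) + σ 0 1 * σ 4 v := by
  have hloop := loopStore_induction (x := 6) (σ := σ) (K := σ 0 0) (f := rowProg.exec)
    (fun k τ => (∀ a ≤ 4, τ a = σ a) ∧ τ 9 0 = σ 9 0 + k * σ 0 0 ∧
      ∀ v < k, τ 5 v =
        (∑ w ∈ Finset.range (σ 0 0), σ 1 (σ 9 0 + v * σ 0 0 + w) * σ 4 w) + σ 0 1 * σ 4 v)
    ⟨fun _ _ => rfl, by simp, by simp⟩ ?_ _ le_rfl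
  · obtain ⟨h1, h2, h3⟩ := hloop
    simp only [stepProg, Prog.exec, Expr.eval]
    set τ := loopStore _ 6 σ (σ 0 0) with hτ
    obtain ⟨h4, h5⟩ := copyProg_exec (a := 4) (b := 5) (by decide) (by decide) (by decide) τ
    refine ⟨fun a ha => ?_, ?_, fun v hv => ?_⟩
    · rw [h4 a (by omega) (by omega), h1 a (by omega)]
    · rw [h4 9 (by decide) (by decide), h2]
    · rw [h5 v (by rwa [h1 0 (by decide)]), h3 v hv]
  · rintro k - τ ⟨h1, h2, h3⟩
    obtain ⟨h4, h5, h6⟩ := rowProg_exec (τ.set 6 0 k)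
    have hs : ∀ a ≤ 4, τ.set 6 0 k a = σ a := fun a ha => by
      rw [Store.set_of_ne _ _ _ _ (by omega), h1 a ha]
    refine ⟨fun a ha => ?_, ?_, fun v hv => ?_⟩
    · rw [h4 a (by omega) (by omega) (by omega) (by omega) (by omega), hs a ha]
    · rw [h5, hs 0 (by decide), Store.set_of_ne _ _ _ _ (by decide), h2]
      ring
    · rw [h6, hs 0 (by decide), hs 1 (by decide), hs 4 (by decide)]
      simp only [Store.set_apply]
      by_cases hvk : v = k
      · simp [hvk, h2]
      · simp [hvk, h3 v (by omega)]

/-- The number of indices `w < n` that precede `v` in the order of the entries of `u`, with ties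
broken by the indices. -/
def rank (n : ℕ) (u : ℕ → ℕ) (v : ℕ) : ℕ :=
  ∑ w ∈ Finset.range n, if u w < u v + (if w < v then 1 else 0) then 1 else 0

theorem rankProg_exec (σ : Store) :
    ∀ v < σ 0 0, rankProg.exec σ 3 v =
      if rank (σ 0 0) (σ 4) v + rank (σ 0 0) (σ 4) v + 1 < σ 0 0 then 1 else 0 := by
  refine (loopStore_induction
    (fun k τ => (τ 0 = σ 0 ∧ τ 4 = σ 4) ∧ ∀ v < k, τ 3 v =
      if rank (σ 0 0) (σ 4) v + rank (σ 0 0) (σ 4) v + 1 < σ 0 0 then 1 else 0)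
    ⟨⟨rfl, rfl⟩, by simp⟩ ?_ _ le_rfl).2
  rintro k - τ ⟨⟨h0, h4⟩, h3⟩
  have hloop := loopStore_induction (x := 7) (σ := (τ.set 6 0 k).set 8 0 0) (K := σ 0 0)
    (f := (Prog.assign 8 (.lit 0) (.add (.var 8) (.lt (.get 4 (.var 7))
      (.add (.get 4 (.var 6)) (.lt (.var 7) (.var 6)))))).exec)
    (fun j τ' => (τ' 0 = σ 0 ∧ τ' 4 = σ 4 ∧ τ' 3 = τ 3 ∧ τ' 6 0 = k) ∧ τ' 8 0 =
      ∑ w ∈ Finset.range j, if σ 4 w < σ 4 k + (if w < k then 1 else 0) then 1 else 0)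
    ⟨⟨by simp [Store.set_of_ne, h0], by simp [Store.set_of_ne, h4], by simp [Store.set_of_ne],
      by simp [Store.set_apply]⟩, by simp [Store.set_apply]⟩ ?_ _ le_rfl
  · obtain ⟨⟨g0, g4, g3, g6⟩, g8⟩ := hloop
    have he : ((τ.set 6 0 k).set 8 0 0) 0 0 = σ 0 0 := by simp [Store.set_apply, h0]
    simp only [Prog.exec, Expr.eval, he] at g0 g3 g4 g6 g8 ⊢
    set τ' := loopStore _ 7 ((τ.set 6 0 k).set 8 0 0) (σ 0 0) with hτ
    refine ⟨⟨?_, ?_⟩, fun v hv => ?_⟩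
    · rw [Store.set_of_ne _ _ _ _ (by decide), g0]
    · rw [Store.set_of_ne _ _ _ _ (by decide), g4]
    · rw [Store.set_apply, g6, g8, g0, g3]
      by_cases hvk : v = k
      · simp [hvk, rank]
      · simp [hvk, h3 v (by omega)]
  · rintro j - τ' ⟨⟨g0, g4, g3, g6⟩, g8⟩
    refine ⟨⟨?_, ?_, ?_, ?_⟩, ?_⟩
    · simp [Prog.exec, Store.set_of_ne, g0]
    · simp [Prog.exec, Store.set_of_ne, g4]
    · simp [Prog.exec, Store.set_of_ne, g3]
    · simp [Prog.exec, Store.set_apply, g6]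
    · rw [Finset.sum_range_succ, ← g8]
      simp [Prog.exec, Expr.eval, Store.set_apply, g4, g6]

/-- The vector of the cut player after `s` steps, scaled by `(2 * r) ^ s`, for the `0`-`1` vector
`b`. -/
def scaledWalk {n : ℕ} (r : ℕ) (hist : List (Multigraph n)) (b : ℕ → ℕ) : ℕ → ℕ → ℕ
  | 0, v => b v
  | s + 1, v => (∑ w ∈ Finset.range n, entry hist s v w * scaledWalk r hist b s w) +
      r * scaledWalk r hist b s v

theorem rank_congr {n : ℕ} {u u' : ℕ → ℕ} (h : ∀ v < n, u v = u' v) {v : ℕ} (hv : v < n) :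
    rank n u v = rank n u' v := by
  unfold rank
  refine Finset.sum_congr rfl fun w hw => ?_
  rw [h v hv, h w (Finset.mem_range.1 hw)]

theorem input_adj {n m : ℕ} (r : ℕ) (hist : List (Multigraph n)) (ρ : Fin m → Bool) {s v w : ℕ}
    (hv : v < n) (hw : w < n) :
    input r hist ρ 1 (s * (n * n) + v * n + w) = entry hist s v w := by
  have hn : 0 < n := by omega
  have e : s * (n * n) + v * n + w = w + n * (v + n * s) := by ring
  have hp : (w + n * (v + n * s)) / n = v + n * s := by
    rw [Nat.add_mul_div_left _ _ hn, Nat.div_eq_of_lt hw, zero_add]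
  simp only [input]
  rw [e, ← Nat.div_div_eq_div_mul, hp, Nat.add_mul_div_left _ _ hn, Nat.div_eq_of_lt hv, zero_add,
    Nat.add_mul_mod_self_left, Nat.mod_eq_of_lt hv, Nat.add_mul_mod_self_left, Nat.mod_eq_of_lt hw]

theorem cutProg_exec {n m : ℕ} (r : ℕ) (hist : List (Multigraph n)) (ρ : Fin m → Bool) {v : ℕ}
    (hv : v < n) :
    cutProg.exec (input r hist ρ) 3 v ≠ 0 ↔
      2 * rank n (scaledWalk r hist (input r hist ρ 2) hist.length) v + 1 < n := by
  set σ := input r hist ρ with hσ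
  have s00 : σ 0 0 = n := rfl
  have s01 : σ 0 1 = r := rfl
  have s02 : σ 0 2 = hist.length := rfl
  -- The pointer into the adjacency matrices is never initialised by the program; it starts at the
  -- default value `0`.
  have s9 : σ 9 0 = 0 := rfl
  obtain ⟨h1, h2⟩ := copyProg_exec (a := 4) (b := 2) (by decide) (by decide) (by decide) σ
  have hloop := loopStore_induction (x := 10) (σ := (copyProg 4 2).exec σ) (K := hist.length)
    (f := stepProg.exec)
    (fun k τ => (∀ a < 4, τ a = σ a) ∧ τ 9 0 = k * (n * n) ∧
      ∀ v < n, τ 4 v = scaledWalk r hist (σ 2) k v)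
    ⟨fun a ha => h1 a (by omega) (by omega), by rw [h1 9 (by decide) (by decide), s9, zero_mul],
      h2⟩ ?_ _ le_rfl
  · obtain ⟨g1, -, g4⟩ := hloop
    simp only [cutProg, Prog.exec, Expr.eval]
    rw [h1 0 (by decide) (by decide), s02]
    set τ := loopStore _ 10 _ hist.length with hτ
    have h00 : τ 0 0 = n := by rw [g1 0 (by decide), s00]
    rw [rankProg_exec τ v (by rwa [h00]), h00, rank_congr g4 hv, two_mul]
    simp
  · rintro k - τ ⟨g1, g9, g4⟩
    obtain ⟨f1, f9, f4⟩ := stepProg_exec (τ.set 10 0 k)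
    have hs : ∀ a < 10, τ.set 10 0 k a = τ a := fun a ha =>
      Store.set_of_ne _ _ _ _ (by omega)
    rw [hs 0 (by decide), hs 9 (by decide), g1 0 (by decide), g9, s00] at f9
    simp only [hs 0 (by decide), hs 9 (by decide), hs 1 (by decide), hs 4 (by decide), g9,
      g1 0 (by decide), g1 1 (by decide), s00, s01] at f4
    refine ⟨fun a ha => ?_, ?_, fun v hv => ?_⟩
    · rw [f1 a ha, hs a (by omega), g1 a ha]
    · rw [f9]; ring
    · rw [f4 v hv, g4 v hv, scaledWalk]
      congr 1
      refine Finset.sum_congr rfl fun w hw => ?_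
      rw [Finset.mem_range] at hw
      rw [hσ, input_adj r hist ρ hv hw, ← hσ, g4 w hw]

/-- Tie-breaking by index makes precedence a strict linear order. By transitivity every predecessor
of `v` precedes `w`, and `v` itself is counted for `w` only. -/
theorem rank_lt_rank {n : ℕ} {u : ℕ → ℕ} {v w : ℕ} (hv : v < n)
    (h : u v < u w + if v < w then 1 else 0) : rank n u v < rank n u w := by
  unfold rank
  refine Finset.sum_lt_sum (fun x _ => ?_) ⟨v, Finset.mem_range.2 hv, ?_⟩
  · split_ifs at * <;> omega
  · simp [h]

theorem rank_lt {n : ℕ} {u : ℕ → ℕ} {v : ℕ} (hv : v < n) : rank n u v < n := by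
  have : rank n u v < ∑ w ∈ Finset.range n, 1 := by
    unfold rank
    refine Finset.sum_lt_sum (fun x _ => ?_) ⟨v, Finset.mem_range.2 hv, ?_⟩
    · split_ifs <;> omega
    · simp
  simpa using this

theorem rank_injOn (n : ℕ) (u : ℕ → ℕ) : Set.InjOn (rank n u) (Finset.range n) := by
  intro v hv w hw h
  simp only [Finset.coe_range, Set.mem_Iio] at hv hw
  by_contra hne
  by_cases hlt : u v < u w + if v < w then 1 else 0
  · exact (rank_lt_rank hv hlt).ne h
  · refine (rank_lt_rank (u := u) hw ?_).ne' h
    split_ifs at * <;> omega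

/-- Ranks are distinct and below `n`, so they permute `range n`, and the count can be made on ranks.
-/
theorem card_rank_lt (n : ℕ) (u : ℕ → ℕ) :
    ((Finset.univ : Finset (Fin n)).filter fun v : Fin n => 2 * rank n u v + 1 < n).card = n / 2 := by
  have himg : (Finset.range n).image (rank n u) = Finset.range n := by
    apply Finset.eq_of_subset_of_card_le
    · intro x hx
      obtain ⟨v, hv, rfl⟩ := Finset.mem_image.1 hx
      exact Finset.mem_range.2 (rank_lt (Finset.mem_range.1 hv))
    · rw [Finset.card_image_of_injOn (rank_injOn n u)]
  -- For both parities of `n`, `2 * i + 1 < n` is the division-free form of `i < n / 2`.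
  have hfil : (Finset.range n).filter (fun i => 2 * i + 1 < n) = Finset.range (n / 2) := by
    ext i
    simp only [Finset.mem_filter, Finset.mem_range]
    omega
  have hcard := congrArg Finset.card hfil
  rw [Finset.card_range, ← himg, Finset.filter_image, Finset.card_image_of_injOn
    ((rank_injOn n u).mono (Finset.coe_subset.2 (Finset.filter_subset _ _)))] at hcard
  rw [← hcard]
  refine Finset.card_bij (fun v _ => (v : ℕ)) (fun v hv => ?_) (fun v _ w _ h => Fin.ext h)
    (fun v hv => ?_)
  · simpa using hv
  · simp only [Finset.mem_filter, Finset.mem_range] at hv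
    exact ⟨⟨v, hv.1⟩, by simpa using hv.2, rfl⟩

theorem mem_cut_iff {n r : ℕ} {hist : List (Multigraph n)} {ρ : cutStrategy.Coins n r}
    {v : Fin n} : v ∈ cutStrategy.cut r hist ρ ↔
      2 * rank n (scaledWalk r hist (input r hist ρ 2) hist.length) v + 1 < n := by
  simp only [CutStrategy.cut, Finset.mem_filter, Finset.mem_univ, true_and]
  exact cutProg_exec r hist ρ v.2

theorem card_cut {n r : ℕ} (hist : List (Multigraph n)) (ρ : cutStrategy.Coins n r) :
    (cutStrategy.cut r hist ρ).card = n / 2 := by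
  rw [← card_rank_lt n (scaledWalk r hist (input r hist ρ 2) hist.length)]
  congr 1
  ext v
  simp [mem_cut_iff]

theorem cutStrategy_isValid : cutStrategy.IsValid :=
  fun _ _ hist _ ρ => Or.inl (card_cut hist ρ)

theorem scaledWalk_le_of_mem_cut {n r : ℕ} {hist : List (Multigraph n)}
    {ρ : cutStrategy.Coins n r} {v w : Fin n} (hv : v ∈ cutStrategy.cut r hist ρ)
    (hw : w ∉ cutStrategy.cut r hist ρ) :
    scaledWalk r hist (input r hist ρ 2) hist.length v ≤
      scaledWalk r hist (input r hist ρ 2) hist.length w := by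
  rw [mem_cut_iff] at hv hw
  by_contra h
  have := rank_lt_rank (n := n) (u := scaledWalk r hist (input r hist ρ 2) hist.length) w.2
    (w := v) (by split_ifs <;> omega)
  omega

/-! ### Random signs -/

/-- The sign of a random bit. -/
noncomputable def sgn (b : Bool) : ℝ := if b then 1 else -1

theorem sgn_mul_self (b : Bool) : sgn b * sgn b = 1 := by cases b <;> simp [sgn]

theorem sgn_not (b : Bool) : sgn (!b) = -sgn b := by cases b <;> simp [sgn]

/-- The two-sided Chernoff argument: where `|t * X|` is at least `L`, one of the two exponentials is
at least `exp L`. The factors `1` and `-1` allow one moment bound to serve both signs. -/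
theorem card_mul_exp_le {Ω : Type} [Fintype Ω] {F : Finset Ω} (X : Ω → ℝ) {t L c : ℝ}
    (hF : ∀ ρ ∈ F, L ≤ |t * X ρ|) (h1 : ∑ ρ, Real.exp (1 * t * X ρ) ≤ c)
    (h2 : ∑ ρ, Real.exp (-1 * t * X ρ) ≤ c) : (F.card : ℝ) * Real.exp L ≤ 2 * c := by
  calc (F.card : ℝ) * Real.exp L = ∑ ρ ∈ F, Real.exp L := by simp
    _ ≤ ∑ ρ ∈ F, (Real.exp (1 * t * X ρ) + Real.exp (-1 * t * X ρ)) := by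
        refine Finset.sum_le_sum fun ρ hρ => ?_
        have p1 := Real.exp_pos (1 * t * X ρ)
        have p2 := Real.exp_pos (-1 * t * X ρ)
        rcases le_abs'.1 (hF ρ hρ) with h | h
        · have : Real.exp L ≤ Real.exp (-1 * t * X ρ) := Real.exp_le_exp.2 (by linarith)
          linarith
        · have : Real.exp L ≤ Real.exp (1 * t * X ρ) := Real.exp_le_exp.2 (by linarith)
          linarith
    _ ≤ ∑ ρ, (Real.exp (1 * t * X ρ) + Real.exp (-1 * t * X ρ)) :=
        Finset.sum_le_univ_sum_of_nonneg fun ρ => (add_pos (Real.exp_pos _) (Real.exp_pos _)).le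
    _ ≤ _ := by rw [Finset.sum_add_distrib]; linarith

section Signs

variable {ι : Type} [Fintype ι] [DecidableEq ι]

/-- For `i ≠ j`, flipping bit `i` is an involution that negates every summand. -/
theorem sum_sgn_mul_sgn (i j : ι) :
    ∑ ρ : ι → Bool, sgn (ρ i) * sgn (ρ j) =
      if i = j then (Fintype.card (ι → Bool) : ℝ) else 0 := by
  split_ifs with h
  · subst h
    simp [sgn_mul_self]
  · have hinv : Function.Involutive fun ρ : ι → Bool => Function.update ρ i (!ρ i) := fun ρ => by
      simp
    have := Equiv.sum_comp (hinv.toPerm _) fun ρ : ι → Bool => sgn (ρ i) * sgn (ρ j)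
    simp only [Function.Involutive.coe_toPerm, Function.update_self,
      Function.update_of_ne (Ne.symm h), sgn_not, neg_mul, Finset.sum_neg_distrib] at this
    linarith

theorem sum_sq_signs (a : ι → ℝ) :
    ∑ ρ : ι → Bool, (∑ i, a i * sgn (ρ i)) ^ 2 =
      (Fintype.card (ι → Bool) : ℝ) * ∑ i, a i ^ 2 := by
  calc ∑ ρ : ι → Bool, (∑ i, a i * sgn (ρ i)) ^ 2
      = ∑ ρ : ι → Bool, ∑ i, ∑ j, a i * a j * (sgn (ρ i) * sgn (ρ j)) := by
        refine Finset.sum_congr rfl fun ρ _ => ?_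
        rw [sq, Finset.sum_mul_sum]
        refine Finset.sum_congr rfl fun i _ => Finset.sum_congr rfl fun j _ => ?_
        ring
    _ = ∑ i, ∑ j, a i * a j * ∑ ρ : ι → Bool, sgn (ρ i) * sgn (ρ j) := by
        rw [Finset.sum_comm]
        refine Finset.sum_congr rfl fun i _ => ?_
        rw [Finset.sum_comm]
        refine Finset.sum_congr rfl fun j _ => ?_
        rw [Finset.mul_sum]
    _ = _ := by
        simp only [sum_sgn_mul_sgn, mul_ite, mul_zero, Finset.sum_ite_eq, Finset.mem_univ, if_true,
          Finset.mul_sum]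
        refine Finset.sum_congr rfl fun i _ => ?_
        ring

/-- The exponential moment factors over independent bits, and each factor is controlled by `cosh x ≤
exp (x ^ 2 / 2)`. -/
theorem sum_exp_signs_le (a : ι → ℝ) :
    ∑ ρ : ι → Bool, Real.exp (∑ i, a i * sgn (ρ i)) ≤
      (Fintype.card (ι → Bool) : ℝ) * Real.exp ((∑ i, a i ^ 2) / 2) := by
  have h1 : ∑ ρ : ι → Bool, Real.exp (∑ i, a i * sgn (ρ i)) =
      ∏ i, ∑ b : Bool, Real.exp (a i * sgn b) := by
    rw [Finset.prod_univ_sum, Fintype.piFinset_univ]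
    exact Finset.sum_congr rfl fun ρ _ => Real.exp_sum _ _
  have h2 : (Fintype.card (ι → Bool) : ℝ) * Real.exp ((∑ i, a i ^ 2) / 2) =
      ∏ i, (2 * Real.exp (a i ^ 2 / 2)) := by
    rw [Finset.prod_mul_distrib, ← Real.exp_sum, Finset.sum_div]
    simp
  rw [h1, h2]
  refine Finset.prod_le_prod (fun i _ => Finset.sum_nonneg fun b _ => (Real.exp_pos _).le)
    fun i _ => ?_
  have := Real.cosh_le_exp_half_sq (a i)
  rw [Real.cosh_eq] at this
  simp only [Fintype.sum_bool, sgn, if_true, mul_one, mul_neg, Bool.false_eq_true, if_false]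
  linarith

theorem sum_exp_mul_signs_le (a : ι → ℝ) (t : ℝ) :
    ∑ ρ : ι → Bool, Real.exp (t * ∑ i, a i * sgn (ρ i)) ≤
      (Fintype.card (ι → Bool) : ℝ) * Real.exp (t ^ 2 * (∑ i, a i ^ 2) / 2) := by
  have := sum_exp_signs_le fun i => t * a i
  simp only [mul_pow, mul_assoc, ← Finset.mul_sum] at this
  exact this

theorem card_signs_tail_le (a : ι → ℝ) {L : ℝ} (hL : 0 ≤ L) :
    ((Finset.univ.filter fun ρ : ι → Bool =>
        L * ∑ i, a i ^ 2 < (∑ i, a i * sgn (ρ i)) ^ 2).card : ℝ) ≤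
      2 * Real.exp (-L / 2) * (Fintype.card (ι → Bool) : ℝ) := by
  have hexp := sum_exp_mul_signs_le a
  have hV0 : 0 ≤ ∑ i, a i ^ 2 := Finset.sum_nonneg fun i _ => sq_nonneg _
  -- If all coefficients vanish, the strict inequality makes the event empty.
  rcases hV0.eq_or_lt with h0 | hpos
  · have ha : ∀ i, a i = 0 := fun i => by
      have := (Finset.sum_eq_zero_iff_of_nonneg (fun i _ => sq_nonneg (a i))).1 h0.symm i
        (Finset.mem_univ i)
      exact pow_eq_zero_iff (two_ne_zero) |>.1 this
    rw [Finset.filter_eq_empty_iff.2 fun ρ _ => by simp [ha]]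
    simp only [Finset.card_empty, Nat.cast_zero]
    positivity
  · generalize ∑ i, a i ^ 2 = V at hexp hpos ⊢
    generalize hX : (fun ρ : ι → Bool => ∑ i, a i * sgn (ρ i)) = X at hexp
    have hXρ : ∀ ρ : ι → Bool, ∑ i, a i * sgn (ρ i) = X ρ := fun ρ => by rw [← hX]
    simp only [hXρ] at hexp ⊢
    -- The optimal Chernoff parameter: the moment bound becomes `exp (L / 2)`, while the event
    -- forces `|t * X| ≥ L`.
    have ht2 : Real.sqrt (L / V) ^ 2 = L / V := Real.sq_sqrt (by positivity)
    generalize Real.sqrt (L / V) = t at ht2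
    have h1 := hexp (1 * t)
    have h2 := hexp (-1 * t)
    have e : ∀ s : ℝ, s ^ 2 = 1 → (s * t) ^ 2 * V = L := fun s hs => by
      rw [mul_pow, hs, ht2]; field_simp
    rw [e 1 (by norm_num)] at h1
    rw [e (-1) (by norm_num)] at h2
    have hF := card_mul_exp_le
      (F := Finset.univ.filter fun ρ : ι → Bool => L * V < X ρ ^ 2) (L := L) X (fun ρ hρ => ?_)
      h1 h2
    · have e1 : Real.exp (L / 2) = Real.exp (-L / 2) * Real.exp L := by
        rw [← Real.exp_add]; ring_nf
      rw [e1] at hF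
      refine le_of_mul_le_mul_right (hF.trans (le_of_eq ?_)) (Real.exp_pos L)
      ring
    · have hρ' := (Finset.mem_filter.1 hρ).2
      rw [← abs_of_nonneg hL, ← sq_le_sq, mul_pow, ht2]
      have : L ^ 2 = L / V * (L * V) := by field_simp
      rw [this]
      exact mul_le_mul_of_nonneg_left hρ'.le (by positivity)

end Signs

variable {n r : ℕ}

/-- The random bit that belongs to the vertex `v`. -/
def coin (v : Fin n) : Fin (cutStrategy.coins.eval (n + r)) :=
  ⟨v, by simp only [cutStrategy, Polynomial.eval_X]; omega⟩

theorem coin_injective : Function.Injective (coin (n := n) (r := r)) := fun v w h => by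
  simpa [coin, Fin.ext_iff] using h

/-- The strategy receives `n + r` bits but uses one per vertex. Extending the coefficients by zero
reduces to sums over all bits. -/
theorem sum_signs_eq (x : Fin n → ℝ) (ρ : cutStrategy.Coins n r) :
    ∑ v, x v * sgn (ρ (coin v)) = ∑ i, Function.extend coin x 0 i * sgn (ρ i) := by
  refine Fintype.sum_of_injective coin coin_injective _ _ (fun i hi => ?_) fun v => ?_
  · rw [Function.extend_apply' _ _ _ (by simpa using hi)]
    simp
  · rw [coin_injective.extend_apply]

theorem sum_sq_eq (x : Fin n → ℝ) :
    ∑ v, x v ^ 2 =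
      ∑ i : Fin (cutStrategy.coins.eval (n + r)), Function.extend coin x 0 i ^ 2 := by
  refine Fintype.sum_of_injective coin coin_injective _ _ (fun i hi => ?_) fun v => ?_
  · rw [Function.extend_apply' _ _ _ (by simpa using hi)]
    simp
  · rw [coin_injective.extend_apply]

theorem sum_sq_coins (x : Fin n → ℝ) :
    ∑ ρ : cutStrategy.Coins n r, (∑ v, x v * sgn (ρ (coin v))) ^ 2 =
      (Fintype.card (cutStrategy.Coins n r) : ℝ) * ∑ v, x v ^ 2 := by
  simp only [sum_signs_eq]
  rw [sum_sq_signs, ← sum_sq_eq]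

theorem card_coins_tail_le (x : Fin n → ℝ) {L : ℝ} (hL : 0 ≤ L) :
    ((Finset.univ.filter fun ρ : cutStrategy.Coins n r =>
        L * ∑ v, x v ^ 2 < (∑ v, x v * sgn (ρ (coin v))) ^ 2).card : ℝ) ≤
      2 * Real.exp (-L / 2) * (Fintype.card (cutStrategy.Coins n r) : ℝ) := by
  simp only [sum_signs_eq, sum_sq_eq (r := r) x]
  exact card_signs_tail_le _ hL

/-! ### The lazy random walk -/

theorem lazyWalk_symm (r : ℕ) (G : Multigraph n) (v w : Fin n) :
    lazyWalk r G v w = lazyWalk r G w v := by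
  simp only [lazyWalk, G.symm v w, eq_comm (a := v)]

theorem lazyWalk_nonneg (r : ℕ) (G : Multigraph n) (v w : Fin n) : 0 ≤ lazyWalk r G v w := by
  unfold lazyWalk
  positivity

theorem lazyWalk_mulVec (r : ℕ) (G : Multigraph n) (f : Fin n → ℝ) (v : Fin n) :
    (lazyWalk r G).mulVec f v = f v / 2 + (∑ w, (G.adj v w : ℝ) * f w) / (2 * r) := by
  simp only [Matrix.mulVec, dotProduct, lazyWalk, add_mul, Finset.sum_add_distrib, ite_mul,
    zero_mul, Finset.sum_ite_eq, Finset.mem_univ, if_true, Finset.sum_div]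
  congr 1
  · ring
  · exact Finset.sum_congr rfl fun w _ => by ring

theorem Multigraph.IsRegular.sum_adj {G : Multigraph n} (hG : G.IsRegular r) (v : Fin n) :
    ∑ w, (G.adj v w : ℝ) = r := by
  exact_mod_cast hG v

theorem Multigraph.IsRegular.sum_adj' {G : Multigraph n} (hG : G.IsRegular r) (w : Fin n) :
    ∑ v, (G.adj v w : ℝ) = r := by
  simp only [fun v => G.symm v w, hG.sum_adj]

theorem lazyWalk_sum_row (hr : 1 ≤ r) {G : Multigraph n} (hG : G.IsRegular r) (v : Fin n) :
    ∑ w, lazyWalk r G v w = 1 := by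
  have h0 : (r : ℝ) ≠ 0 := by positivity
  have := lazyWalk_mulVec r G (fun _ => 1) v
  simp only [Matrix.mulVec, dotProduct, mul_one, hG.sum_adj] at this
  rw [this]
  field_simp
  norm_num

theorem lazyWalk_sum_col (hr : 1 ≤ r) {G : Multigraph n} (hG : G.IsRegular r) (w : Fin n) :
    ∑ v, lazyWalk r G v w = 1 := by
  simp only [fun v => lazyWalk_symm r G v w, lazyWalk_sum_row hr hG]

theorem walk_append (r : ℕ) (hist : List (Multigraph n)) (G : Multigraph n) :
    walk r (hist ++ [G]) = lazyWalk r G * walk r hist := by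
  simp [walk]

theorem walk_sum_row (hr : 1 ≤ r) {hist : List (Multigraph n)}
    (h : ∀ G ∈ hist, G.IsRegular r) (v : Fin n) : ∑ j, walk r hist v j = 1 := by
  induction hist using List.reverseRecOn generalizing v with
  | nil => simp [walk, Matrix.one_apply]
  | append_singleton hist G ih =>
    simp only [List.mem_append, List.mem_singleton] at h
    simp only [walk_append, Matrix.mul_apply]
    rw [Finset.sum_comm]
    simp only [← Finset.mul_sum, ih fun G hG => h G (Or.inl hG), mul_one]
    exact lazyWalk_sum_row hr (h G (Or.inr rfl)) v

theorem walk_sum_col (hr : 1 ≤ r) {hist : List (Multigraph n)}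
    (h : ∀ G ∈ hist, G.IsRegular r) (j : Fin n) : ∑ v, walk r hist v j = 1 := by
  induction hist using List.reverseRecOn with
  | nil => simp [walk, Matrix.one_apply]
  | append_singleton hist G ih =>
    simp only [List.mem_append, List.mem_singleton] at h
    simp only [walk_append, Matrix.mul_apply]
    rw [Finset.sum_comm]
    simp only [← Finset.sum_mul, lazyWalk_sum_col hr (h G (Or.inr rfl)), one_mul]
    exact ih fun G hG => h G (Or.inl hG)

theorem scaledWalk_eq (hr : 1 ≤ r) (hist : List (Multigraph n)) (b : ℕ → ℕ) {s : ℕ}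
    (hs : s ≤ hist.length) (v : Fin n) :
    (scaledWalk r hist b s v : ℝ) =
      (2 * r) ^ s * (walk r (hist.take s)).mulVec (fun w : Fin n => (b w : ℝ)) v := by
  have h0 : (r : ℝ) ≠ 0 := by positivity
  induction s generalizing v with
  | zero => simp [walk, scaledWalk]
  | succ s ih =>
    have ih := ih (by omega)
    have hs' : s < hist.length := hs
    rw [List.take_add_one, List.getElem?_eq_getElem hs', Option.toList_some, walk_append,
      ← Matrix.mulVec_mulVec, lazyWalk_mulVec, scaledWalk]
    push_cast
    rw [ih, Finset.sum_range]
    have hent : ∀ w : Fin n, entry hist s v w = (hist[s]).adj v w := fun w => by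
      simp [entry, List.getElem?_eq_getElem hs']
    simp only [hent, ih]
    have : ∀ w : Fin n, ((hist[s]).adj v w : ℝ) * ((2 * r) ^ s *
        (walk r (hist.take s)).mulVec (fun w : Fin n => (b w : ℝ)) w) =
        (2 * r) ^ s * (((hist[s]).adj v w : ℝ) *
        (walk r (hist.take s)).mulVec (fun w : Fin n => (b w : ℝ)) w) := fun w => by ring
    simp only [this, ← Finset.mul_sum, pow_succ]
    field_simp
    ring

/-- The deviation of the walk matrix from the uniform distribution. -/
noncomputable def dev (r : ℕ) (hist : List (Multigraph n)) (v j : Fin n) : ℝ :=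
  walk r hist v j - 1 / n

theorem dev_sum_col (hr : 1 ≤ r) {hist : List (Multigraph n)}
    (h : ∀ G ∈ hist, G.IsRegular r) (j : Fin n) : ∑ v, dev r hist v j = 0 := by
  have : (n : ℝ) ≠ 0 := by have := j.pos; positivity
  simp [dev, walk_sum_col hr h, this]

/-- The projection of the rows of the walk matrix to the random direction. -/
noncomputable def proj (r : ℕ) (hist : List (Multigraph n)) (ρ : cutStrategy.Coins n r)
    (v : Fin n) : ℝ :=
  ∑ j, dev r hist v j * sgn (ρ (coin j))

/-- Subtracting `1 / n` from every matrix entry has the same effect as centring the sign vector,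
because rows of the walk sum to one. -/
theorem walk_mulVec_eq_proj (hr : 1 ≤ r) {hist : List (Multigraph n)}
    (h : ∀ G ∈ hist, G.IsRegular r) (ρ : cutStrategy.Coins n r) (v : Fin n) :
    (walk r hist).mulVec (fun j => sgn (ρ (coin j)) - (∑ w, sgn (ρ (coin w))) / n) v =
      proj r hist ρ v := by
  simp only [Matrix.mulVec, dotProduct, proj, dev, mul_sub, sub_mul, Finset.sum_sub_distrib,
    ← Finset.sum_mul, ← Finset.mul_sum, walk_sum_row hr h]
  ring

/-- A bit is half of its sign plus one, and the walk fixes constants. So the integer vector of the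
program is a positive multiple of the projection plus a constant, and it orders the vertices
identically. -/
theorem scaledWalk_eq_proj (hr : 1 ≤ r) {hist : List (Multigraph n)}
    (h : ∀ G ∈ hist, G.IsRegular r) (ρ : cutStrategy.Coins n r) (v : Fin n) :
    2 * (scaledWalk r hist (input r hist ρ 2) hist.length v : ℝ) =
      (2 * r) ^ hist.length * (proj r hist ρ v + 1 + (∑ w, sgn (ρ (coin w))) / n) := by
  have hb : ∀ w : Fin n, (input r hist ρ 2 w : ℝ) = (sgn (ρ (coin w)) + 1) / 2 := fun w => by
    have hw : (w : ℕ) < cutStrategy.coins.eval (n + r) := (coin w).2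
    have : input r hist ρ 2 w = (ρ (coin w)).toNat := by
      simp only [input, hw, dif_pos]
      rfl
    rw [this]
    cases ρ (coin w) <;> simp [sgn]
  rw [scaledWalk_eq hr hist _ le_rfl, List.take_length, ← walk_mulVec_eq_proj hr h]
  simp only [hb, Matrix.mulVec, dotProduct, mul_sub, mul_div_assoc', mul_add, mul_one,
    ← Finset.sum_div, Finset.sum_add_distrib, Finset.sum_sub_distrib, ← Finset.sum_mul,
    walk_sum_row hr h]
  ring

theorem proj_le_of_mem_cut (hr : 1 ≤ r) {hist : List (Multigraph n)}
    (h : ∀ G ∈ hist, G.IsRegular r) {ρ : cutStrategy.Coins n r} {v w : Fin n}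
    (hv : v ∈ cutStrategy.cut r hist ρ) (hw : w ∉ cutStrategy.cut r hist ρ) :
    proj r hist ρ v ≤ proj r hist ρ w := by
  have h1 : (scaledWalk r hist (input r hist ρ 2) hist.length v : ℝ) ≤
      scaledWalk r hist (input r hist ρ 2) hist.length w := by
    exact_mod_cast scaledWalk_le_of_mem_cut hv hw
  have hv' := scaledWalk_eq_proj hr h ρ v
  have hw' := scaledWalk_eq_proj hr h ρ w
  have h2 : ((2 * r : ℝ)) ^ hist.length * (proj r hist ρ v + 1 + (∑ w, sgn (ρ (coin w))) / n) ≤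
      (2 * r) ^ hist.length * (proj r hist ρ w + 1 + (∑ w, sgn (ρ (coin w))) / n) := by
    linarith
  have := le_of_mul_le_mul_left h2 (by positivity)
  linarith

theorem cutStrategy_isWalkProjection : cutStrategy.IsWalkProjection := by
  intro n r hr
  refine ⟨fun ρ v => sgn (ρ (coin v)) - (∑ w, sgn (ρ (coin w))) / n, fun ρ => ?_,
    fun x hx => ?_, fun hist h ρ => ⟨card_cut hist ρ, fun v hv w hw => ?_⟩⟩
  · rcases Nat.eq_zero_or_pos n with rfl | hn
    · simp
    · have : (n : ℝ) ≠ 0 := by positivity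
      simp only [Finset.sum_sub_distrib, Finset.sum_const, Finset.card_univ, Fintype.card_fin,
        nsmul_eq_mul]
      field_simp
      ring
  · simp only [mul_sub, Finset.sum_sub_distrib, ← Finset.sum_mul, hx, zero_mul, sub_zero]
    rw [sum_sq_coins, mul_comm, mul_div_assoc, div_self, mul_one]
    positivity
  · rw [walk_mulVec_eq_proj hr h, walk_mulVec_eq_proj hr h]
    exact proj_le_of_mem_cut hr h hv hw

/-! ### The potential -/

/-- Write the step as `(I + Q) / 2`. Expanding the square and using that `Q` is a contraction
(Cauchy–Schwarz, `hcs`) leaves `(‖f‖² + ⟨f, Q f⟩) / 2`, and `‖f‖² - ⟨f, Q f⟩` is the Dirichlet form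
divided by `2 * r`. -/
theorem sum_lazyWalk_sq_le (hr : 1 ≤ r) {G : Multigraph n} (hG : G.IsRegular r)
    (f : Fin n → ℝ) :
    ∑ v, (lazyWalk r G).mulVec f v ^ 2 ≤
      ∑ v, f v ^ 2 - (∑ v, ∑ w, (G.adj v w : ℝ) * (f v - f w) ^ 2) / (4 * r) := by
  have hr0 : (0 : ℝ) < r := by positivity
  set g : Fin n → ℝ := fun v => ∑ w, (G.adj v w : ℝ) * f w with hg
  have hcs : ∀ v, g v ^ 2 ≤ r * ∑ w, (G.adj v w : ℝ) * f w ^ 2 := fun v => by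
    have := Finset.sum_sq_le_sum_mul_sum_of_sq_le_mul Finset.univ
      (r := fun w => (G.adj v w : ℝ) * f w) (f := fun w => (G.adj v w : ℝ))
      (g := fun w => (G.adj v w : ℝ) * f w ^ 2) (fun w _ => by positivity)
      (fun w _ => by positivity) (fun w _ => le_of_eq (by ring))
    rwa [hG.sum_adj] at this
  have hcol : ∑ v, ∑ w, (G.adj v w : ℝ) * f w ^ 2 = r * ∑ v, f v ^ 2 := by
    rw [Finset.sum_comm]
    simp only [← Finset.sum_mul, hG.sum_adj', ← Finset.mul_sum]
  have hrow : ∑ v, ∑ w, (G.adj v w : ℝ) * f v ^ 2 = r * ∑ v, f v ^ 2 := by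
    simp only [← Finset.sum_mul, hG.sum_adj, ← Finset.mul_sum]
  have hgg : ∑ v, g v ^ 2 ≤ r * (r * ∑ v, f v ^ 2) := by
    rw [← hcol, Finset.mul_sum]
    exact Finset.sum_le_sum fun v _ => hcs v
  have hE : ∑ v, ∑ w, (G.adj v w : ℝ) * (f v - f w) ^ 2 =
      2 * (r * ∑ v, f v ^ 2) - 2 * ∑ v, f v * g v := by
    have : ∀ v w, (G.adj v w : ℝ) * (f v - f w) ^ 2 = (G.adj v w : ℝ) * f v ^ 2 +
      (G.adj v w : ℝ) * f w ^ 2 - 2 * (f v * ((G.adj v w : ℝ) * f w)) := fun v w => by ring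
    simp only [this, Finset.sum_sub_distrib, Finset.sum_add_distrib, hcol, hrow, hg,
      ← Finset.mul_sum]
    ring
  have hM : ∑ v, (lazyWalk r G).mulVec f v ^ 2 =
      (∑ v, f v ^ 2) / 4 + (∑ v, f v * g v) / (2 * r) + (∑ v, g v ^ 2) / (4 * r ^ 2) := by
    simp only [Finset.sum_div, ← Finset.sum_add_distrib]
    refine Finset.sum_congr rfl fun v _ => ?_
    rw [lazyWalk_mulVec]
    simp only [hg]
    field_simp
    ring
  have h4 : (∑ v, g v ^ 2) / (4 * r ^ 2) ≤ (∑ v, f v ^ 2) / 4 := by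
    rw [div_le_div_iff₀ (by positivity) (by norm_num)]
    nlinarith
  have h5 : (2 * (r * ∑ v, f v ^ 2) - 2 * ∑ v, f v * g v) / (4 * r) =
      (∑ v, f v ^ 2) / 2 - (∑ v, f v * g v) / (2 * r) := by
    field_simp
    ring
  rw [hM, hE, h5]
  linarith

/-- The squared distance of the walk matrix from the uniform one. -/
noncomputable def potential (r : ℕ) (hist : List (Multigraph n)) : ℝ :=
  ∑ v, ∑ j, dev r hist v j ^ 2

theorem potential_nonneg (r : ℕ) (hist : List (Multigraph n)) : 0 ≤ potential r hist :=
  Finset.sum_nonneg fun _ _ => Finset.sum_nonneg fun _ _ => sq_nonneg _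

/-- The squared distance of two rows of the walk matrix. -/
noncomputable def rowDist (r : ℕ) (hist : List (Multigraph n)) (v w : Fin n) : ℝ :=
  ∑ j, (dev r hist v j - dev r hist w j) ^ 2

theorem dev_append (hr : 1 ≤ r) (hist : List (Multigraph n)) {G : Multigraph n}
    (hG : G.IsRegular r) (v j : Fin n) :
    dev r (hist ++ [G]) v j = (lazyWalk r G).mulVec (fun w => dev r hist w j) v := by
  simp only [dev, walk_append, Matrix.mul_apply, Matrix.mulVec, dotProduct, mul_sub,
    Finset.sum_sub_distrib, ← Finset.sum_mul, lazyWalk_sum_row hr hG, one_mul]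

theorem potential_append_le (hr : 1 ≤ r) (hist : List (Multigraph n)) {G : Multigraph n}
    (hG : G.IsRegular r) :
    potential r (hist ++ [G]) ≤
      potential r hist - (∑ v, ∑ w, (G.adj v w : ℝ) * rowDist r hist v w) / (4 * r) := by
  have h1 : potential r (hist ++ [G]) =
      ∑ j, ∑ v, (lazyWalk r G).mulVec (fun w => dev r hist w j) v ^ 2 := by
    unfold potential
    rw [Finset.sum_comm]
    simp only [dev_append hr hist hG]
  have h2 : ∑ v, ∑ w, (G.adj v w : ℝ) * rowDist r hist v w =
      ∑ j, ∑ v, ∑ w, (G.adj v w : ℝ) * (dev r hist v j - dev r hist w j) ^ 2 := by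
    simp only [rowDist, Finset.mul_sum]
    rw [Finset.sum_comm' (t' := Finset.univ) (s' := fun _ => Finset.univ) (by simp)]
    conv_rhs => rw [Finset.sum_comm]
    rw [Finset.sum_comm]
    exact Finset.sum_congr rfl fun v _ => Finset.sum_comm
  have h3 : potential r hist = ∑ j, ∑ v, dev r hist v j ^ 2 := Finset.sum_comm
  rw [h1, h2, h3, Finset.sum_div, ← Finset.sum_sub_distrib]
  exact Finset.sum_le_sum fun j _ => sum_lazyWalk_sq_le hr hG fun w => dev r hist w j

/-- A weave on a cut that separates the small entries of a vector from the large ones has a large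
Dirichlet form. -/
theorem IsWeave.sum_sq_le {S : Finset (Fin n)} {G : Multigraph n} (hG : IsWeave r S G)
    (hS : S.Nonempty) {u : Fin n → ℝ} (hu : ∑ v, u v = 0)
    (hcut : ∀ v ∈ S, ∀ w ∉ S, u v ≤ u w) :
    ∑ v, u v ^ 2 ≤ ∑ v, ∑ w, (G.adj v w : ℝ) * (u v - u w) ^ 2 := by
  -- The largest value on `S` is a threshold lying between the endpoint values of every crossing
  -- edge.
  obtain ⟨x, hxS, hx⟩ := S.exists_max_image u hS
  have hrow : ∀ v, (u v - u x) ^ 2 ≤ ∑ w, (G.adj v w : ℝ) * (u v - u w) ^ 2 := fun v => by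
    obtain ⟨w, hvw, hadj⟩ := hG.2 v
    have h1 : (1 : ℝ) ≤ G.adj v w := by exact_mod_cast hadj
    have h2 : (u v - u x) ^ 2 ≤ (u v - u w) ^ 2 := by
      by_cases hv : v ∈ S
      · have := hx v hv
        have := hcut x hxS w (hvw.1 hv)
        nlinarith
      · have hw : w ∈ S := by by_contra hw; exact hv (hvw.2 hw)
        have := hx w hw
        have := hcut x hxS v hv
        nlinarith
    calc (u v - u x) ^ 2 ≤ (G.adj v w : ℝ) * (u v - u w) ^ 2 := by nlinarith [sq_nonneg (u v - u w)]
      _ ≤ _ := Finset.single_le_sum (f := fun w => (G.adj v w : ℝ) * (u v - u w) ^ 2)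
          (fun w _ => by positivity) (Finset.mem_univ w)
  -- A vector with mean zero has its least sum of squares about zero.
  calc ∑ v, u v ^ 2 ≤ ∑ v, (u v - u x) ^ 2 := by
        have : ∀ v, (u v - u x) ^ 2 = u v ^ 2 - 2 * u x * u v + u x ^ 2 := fun v => by ring
        simp only [this, Finset.sum_add_distrib, Finset.sum_sub_distrib, ← Finset.mul_sum, hu,
          mul_zero, sub_zero]
        have : 0 ≤ ∑ _v : Fin n, u x ^ 2 := Finset.sum_nonneg fun _ _ => sq_nonneg _
        linarith
    _ ≤ _ := Finset.sum_le_sum fun v _ => hrow v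

theorem sum_proj (hr : 1 ≤ r) {hist : List (Multigraph n)}
    (h : ∀ G ∈ hist, G.IsRegular r) (ρ : cutStrategy.Coins n r) : ∑ v, proj r hist ρ v = 0 := by
  unfold proj
  rw [Finset.sum_comm]
  simp only [← Finset.sum_mul, dev_sum_col hr h, zero_mul, Finset.sum_const_zero]

theorem proj_sub (hist : List (Multigraph n)) (ρ : cutStrategy.Coins n r) (v w : Fin n) :
    proj r hist ρ v - proj r hist ρ w =
      ∑ j, (dev r hist v j - dev r hist w j) * sgn (ρ (coin j)) := by
  simp only [proj, sub_mul, Finset.sum_sub_distrib]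

/-- A worst-case bound by Cauchy–Schwarz, needed only for bad outcomes, where a loss of the factor
`n` is affordable. -/
theorem sum_proj_sq_le (hist : List (Multigraph n)) (ρ : cutStrategy.Coins n r) :
    ∑ v, proj r hist ρ v ^ 2 ≤ n * potential r hist := by
  unfold potential
  rw [Finset.mul_sum]
  refine Finset.sum_le_sum fun v _ => ?_
  have := Finset.sum_mul_sq_le_sq_mul_sq Finset.univ (dev r hist v) fun j => sgn (ρ (coin j))
  simp only [sq (sgn _), sgn_mul_self, Finset.sum_const, Finset.card_univ, Fintype.card_fin,
    nsmul_eq_mul, mul_one] at this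
  unfold proj
  linarith

/-- Some distance between two entries is much larger than expected. -/
def IsBad (L : ℝ) (hist : List (Multigraph n)) (ρ : cutStrategy.Coins n r) : Prop :=
  ∃ v w, L * rowDist r hist v w < (proj r hist ρ v - proj r hist ρ w) ^ 2

open Classical in
theorem card_isBad_le (hist : List (Multigraph n)) {L : ℝ} (hL : 0 ≤ L) :
    ((Finset.univ.filter fun ρ : cutStrategy.Coins n r => IsBad L hist ρ).card : ℝ) ≤
      n ^ 2 * (2 * Real.exp (-L / 2) * (Fintype.card (cutStrategy.Coins n r) : ℝ)) := by
  have hsub : (Finset.univ.filter fun ρ : cutStrategy.Coins n r => IsBad L hist ρ) ⊆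
      (Finset.univ : Finset (Fin n × Fin n)).biUnion fun p =>
        Finset.univ.filter fun ρ : cutStrategy.Coins n r =>
          L * rowDist r hist p.1 p.2 < (proj r hist ρ p.1 - proj r hist ρ p.2) ^ 2 := by
    intro ρ hρ
    obtain ⟨v, w, hvw⟩ := (Finset.mem_filter.1 hρ).2
    simp only [Finset.mem_biUnion, Finset.mem_filter, Finset.mem_univ, true_and]
    exact ⟨(v, w), hvw⟩
  have h1 := (Finset.card_le_card hsub).trans Finset.card_biUnion_le
  have h2 : ∀ p : Fin n × Fin n, ((Finset.univ.filter fun ρ : cutStrategy.Coins n r =>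
          L * rowDist r hist p.1 p.2 < (proj r hist ρ p.1 - proj r hist ρ p.2) ^ 2).card : ℝ) ≤
      2 * Real.exp (-L / 2) * (Fintype.card (cutStrategy.Coins n r) : ℝ) := fun p => by
    simp only [proj_sub, rowDist]
    convert card_coins_tail_le (r := r)
      (fun j => dev r hist p.1 j - dev r hist p.2 j) hL
  calc _ ≤ ((∑ p : Fin n × Fin n, (Finset.univ.filter fun ρ : cutStrategy.Coins n r =>
          L * rowDist r hist p.1 p.2 <
            (proj r hist ρ p.1 - proj r hist ρ p.2) ^ 2).card : ℕ) : ℝ) := by exact_mod_cast h1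
    _ ≤ ∑ p : Fin n × Fin n,
          2 * Real.exp (-L / 2) * (Fintype.card (cutStrategy.Coins n r) : ℝ) := by
        push_cast
        exact Finset.sum_le_sum fun p _ => h2 p
    _ = _ := by
        simp only [Finset.sum_const, Finset.card_univ, Fintype.card_prod, Fintype.card_fin,
          nsmul_eq_mul]
        push_cast
        ring

open Classical in
/-- The potential drop in one round. -/
theorem potential_append_le_proj (hn : 2 ≤ n) (hr : 1 ≤ r) {hist : List (Multigraph n)}
    (h : ∀ G ∈ hist, G.IsRegular r) {L : ℝ} (hL : 0 < L) (ρ : cutStrategy.Coins n r)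
    {G : Multigraph n} (hG : IsWeave r (cutStrategy.cut r hist ρ) G) :
    potential r (hist ++ [G]) ≤ potential r hist -
      (∑ v, proj r hist ρ v ^ 2 - if IsBad L hist ρ then n * potential r hist else 0) /
        (4 * r * L) := by
  have hr0 : (0 : ℝ) < r := by positivity
  have hle := potential_append_le hr hist hG.1
  have hdist : ∀ v w, 0 ≤ rowDist r hist v w := fun v w =>
    Finset.sum_nonneg fun _ _ => sq_nonneg _
  refine hle.trans (sub_le_sub_left ?_ _)
  have e : ∀ x : ℝ, x / (4 * r * L) = x / L / (4 * r) := fun x => by field_simp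
  rw [e]
  gcongr
  rw [div_le_iff₀ hL]
  split_ifs with hbad
  -- On a bad outcome the claimed drop is at most zero, so it is enough that the potential does not
  -- increase.
  · have h1 := sum_proj_sq_le hist ρ
    have h2 : 0 ≤ ∑ v, ∑ w, (G.adj v w : ℝ) * rowDist r hist v w :=
      Finset.sum_nonneg fun v _ => Finset.sum_nonneg fun w _ =>
        mul_nonneg (Nat.cast_nonneg _) (hdist v w)
    nlinarith [mul_nonneg h2 hL.le]
  · have hS : (cutStrategy.cut r hist ρ).Nonempty := by
      rw [← Finset.card_pos, card_cut]
      omega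
    have h1 := hG.sum_sq_le hS (sum_proj hr h ρ) fun v hv w hw => proj_le_of_mem_cut hr h hv hw
    rw [sub_zero, Finset.sum_mul]
    refine h1.trans (Finset.sum_le_sum fun v _ => ?_)
    rw [Finset.sum_mul]
    refine Finset.sum_le_sum fun w _ => ?_
    have : (proj r hist ρ v - proj r hist ρ w) ^ 2 ≤ L * rowDist r hist v w := by
      by_contra hlt
      exact hbad ⟨v, w, not_le.1 hlt⟩
    rw [mul_assoc, mul_comm _ L]
    gcongr

/-- The expected potential drop in one round. -/
theorem sum_potential_append_le (hn : 2 ≤ n) (hr : 1 ≤ r) {hist : List (Multigraph n)}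
    (h : ∀ G ∈ hist, G.IsRegular r) (G : cutStrategy.Coins n r → Multigraph n)
    (hG : ∀ ρ, IsWeave r (cutStrategy.cut r hist ρ) (G ρ)) :
    ∑ ρ, potential r (hist ++ [G ρ]) ≤ (Fintype.card (cutStrategy.Coins n r) : ℝ) *
      ((1 - 1 / (80 * r * Real.log n)) * potential r hist) := by
  classical
  have hr0 : (0 : ℝ) < r := by positivity
  have hn' : (2 : ℝ) ≤ n := by exact_mod_cast hn
  have hlog : 0 < Real.log n := Real.log_pos (by linarith)
  -- This makes the tail `2 / n ^ 5`. After the union bound over `n ^ 2` pairs and the factor `n`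
  -- lost on bad outcomes, `2 / n ^ 2 ≤ 1 / 2` remains, so half of the expected drop survives: `80 =
  -- 2 * 4 * 10`.
  set L : ℝ := 10 * Real.log n with hLdef
  have hL : 0 < L := by positivity
  set N : ℝ := (Fintype.card (cutStrategy.Coins n r) : ℝ) with hN
  have hN0 : 0 ≤ N := Nat.cast_nonneg _
  have hpot := potential_nonneg r hist
  have hproj : ∑ ρ : cutStrategy.Coins n r, ∑ v, proj r hist ρ v ^ 2 = N * potential r hist := by
    rw [Finset.sum_comm]
    simp only [proj, sum_sq_coins, potential, ← Finset.mul_sum, hN]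
  have hbad := card_isBad_le (r := r) hist hL.le
  have hexp : Real.exp (-L / 2) = 1 / (n : ℝ) ^ 5 := by
    have : -L / 2 = -((5 : ℕ) * Real.log n) := by rw [hLdef]; push_cast; ring
    rw [this, Real.exp_neg, Real.exp_nat_mul, Real.exp_log (by linarith), one_div]
  have hbad' : ((Finset.univ.filter fun ρ : cutStrategy.Coins n r => IsBad L hist ρ).card : ℝ) *
      n ≤ N / 2 := by
    rw [hexp] at hbad
    have e : (n : ℝ) ^ 2 * (2 * (1 / (n : ℝ) ^ 5) * N) * n = N * (2 / (n : ℝ) ^ 2) := by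
      field_simp
    have h2 : 2 / (n : ℝ) ^ 2 ≤ 1 / 2 := by
      rw [div_le_div_iff₀ (by positivity) (by norm_num)]
      nlinarith
    calc _ ≤ (n : ℝ) ^ 2 * (2 * (1 / (n : ℝ) ^ 5) * N) * n := by gcongr
      _ = N * (2 / (n : ℝ) ^ 2) := e
      _ ≤ N * (1 / 2) := by gcongr
      _ = _ := by ring
  calc ∑ ρ, potential r (hist ++ [G ρ])
      ≤ ∑ ρ, (potential r hist - (∑ v, proj r hist ρ v ^ 2 -
          if IsBad L hist ρ then n * potential r hist else 0) / (4 * r * L)) :=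
        Finset.sum_le_sum fun ρ _ => potential_append_le_proj hn hr h hL ρ (hG ρ)
    _ = N * potential r hist - (N * potential r hist -
          ((Finset.univ.filter fun ρ : cutStrategy.Coins n r => IsBad L hist ρ).card : ℝ) *
            n * potential r hist) / (4 * r * L) := by
        rw [Finset.sum_sub_distrib, ← Finset.sum_div, Finset.sum_sub_distrib, hproj,
          ← Finset.sum_filter]
        simp only [Finset.sum_const, Finset.card_univ, nsmul_eq_mul, hN, mul_assoc]
    _ ≤ N * potential r hist - (N * potential r hist - N / 2 * potential r hist) /
          (4 * r * L) := by gcongr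
    _ = _ := by
        rw [hLdef]
        field_simp
        ring

theorem potential_nil_le (n r : ℕ) : potential r ([] : List (Multigraph n)) ≤ n := by
  have hrow : ∀ v : Fin n, ∑ j, dev r ([] : List (Multigraph n)) v j ^ 2 ≤ 1 := fun v => by
    have hn : (0 : ℝ) < n := by have := v.pos; positivity
    have : ∀ j, dev r ([] : List (Multigraph n)) v j ^ 2 =
        (if v = j then 1 - 2 / (n : ℝ) else 0) + 1 / (n : ℝ) ^ 2 := fun j => by
      simp only [dev, walk, List.foldl_nil, Matrix.one_apply]
      split_ifs <;> field_simp <;> ring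
    simp only [this, Finset.sum_add_distrib, Finset.sum_ite_eq, Finset.mem_univ, if_true,
      Finset.sum_const, Finset.card_univ, Fintype.card_fin, nsmul_eq_mul]
    have e : (n : ℝ) * (1 / (n : ℝ) ^ 2) = 1 / n := by field_simp
    have e2 : 2 / (n : ℝ) = 1 / n + 1 / n := by ring
    have : 0 < 1 / (n : ℝ) := by positivity
    rw [e, e2]
    linarith
  calc _ ≤ ∑ _v : Fin n, (1 : ℝ) := Finset.sum_le_sum fun v _ => hrow v
    _ = n := by simp

/-! ### Expansion from a small potential -/

theorem walk_mulVec_mem_Icc (hr : 1 ≤ r) {hist : List (Multigraph n)}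
    (h : ∀ G ∈ hist, G.IsRegular r) {f : Fin n → ℝ} (hf : ∀ v, f v ∈ Set.Icc (0 : ℝ) 1)
    (v : Fin n) : (walk r hist).mulVec f v ∈ Set.Icc (0 : ℝ) 1 := by
  induction hist using List.reverseRecOn generalizing v with
  | nil => simpa [walk] using hf v
  | append_singleton hist G ih =>
    simp only [List.mem_append, List.mem_singleton] at h
    have ih := ih fun G hG => h G (Or.inl hG)
    rw [walk_append, ← Matrix.mulVec_mulVec, Matrix.mulVec, dotProduct]
    constructor
    · exact Finset.sum_nonneg fun w _ => mul_nonneg (lazyWalk_nonneg r G v w) (ih w).1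
    · rw [← lazyWalk_sum_row hr (h G (Or.inr rfl)) v]
      exact Finset.sum_le_sum fun w _ => mul_le_of_le_one_right (lazyWalk_nonneg r G v w) (ih w).2

/-- A lazy step moves at most `cutSize / (2 * r)` across a cut. -/
theorem sum_lazyWalk_compl_le (hr : 1 ≤ r) {G : Multigraph n} (hG : G.IsRegular r)
    (S : Finset (Fin n)) {f : Fin n → ℝ} (hf : ∀ v, f v ∈ Set.Icc (0 : ℝ) 1) :
    ∑ v ∈ Sᶜ, (lazyWalk r G).mulVec f v ≤ ∑ v ∈ Sᶜ, f v + (G.cutSize S : ℝ) / (2 * r) := by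
  have hr0 : (0 : ℝ) < r := by positivity
  have h1 : ∀ v, (lazyWalk r G).mulVec f v =
      f v + (∑ w, (G.adj v w : ℝ) * (f w - f v)) / (2 * r) := fun v => by
    rw [lazyWalk_mulVec]
    simp only [mul_sub, Finset.sum_sub_distrib, ← Finset.sum_mul, hG.sum_adj]
    field_simp
    ring
  simp only [h1, Finset.sum_add_distrib, ← Finset.sum_div]
  gcongr
  -- Exchanges inside the complement cancel by antisymmetry.
  have h2 : ∑ v ∈ Sᶜ, ∑ w ∈ Sᶜ, (G.adj v w : ℝ) * (f w - f v) = 0 := by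
    have : ∑ v ∈ Sᶜ, ∑ w ∈ Sᶜ, (G.adj v w : ℝ) * (f w - f v) =
        -∑ v ∈ Sᶜ, ∑ w ∈ Sᶜ, (G.adj v w : ℝ) * (f w - f v) := by
      conv_lhs => rw [Finset.sum_comm]
      simp only [← Finset.sum_neg_distrib]
      refine Finset.sum_congr rfl fun v _ => Finset.sum_congr rfl fun w _ => ?_
      rw [G.symm w v]
      ring
    linarith
  have h3 : ∑ v ∈ Sᶜ, ∑ w ∈ S, (G.adj v w : ℝ) * (f w - f v) ≤ G.cutSize S := by
    unfold Multigraph.cutSize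
    push_cast
    rw [Finset.sum_comm]
    refine Finset.sum_le_sum fun v _ => Finset.sum_le_sum fun w _ => ?_
    rw [G.symm w v]
    have := (hf v).2
    have := (hf w).1
    exact mul_le_of_le_one_right (Nat.cast_nonneg _) (by linarith)
  calc ∑ v ∈ Sᶜ, ∑ w, (G.adj v w : ℝ) * (f w - f v)
      = ∑ v ∈ Sᶜ, ∑ w ∈ S, (G.adj v w : ℝ) * (f w - f v) +
          ∑ v ∈ Sᶜ, ∑ w ∈ Sᶜ, (G.adj v w : ℝ) * (f w - f v) := by
        rw [← Finset.sum_add_distrib]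
        exact Finset.sum_congr rfl fun v _ => (Finset.sum_add_sum_compl S _).symm
    _ ≤ _ := by rw [h2, add_zero]; exact h3

theorem cutSize_sum_append (hist : List (Multigraph n)) (G : Multigraph n)
    (S : Finset (Fin n)) : (Multigraph.sum (hist ++ [G])).cutSize S =
      (Multigraph.sum hist).cutSize S + G.cutSize S := by
  simp [Multigraph.cutSize, Multigraph.sum, Finset.sum_add_distrib]

/-- Start the walk from the indicator of `S`. Its values stay in `[0, 1]`, so each step sends at
most `cutSize / (2 * r)` across, and these amounts add up over the rounds. -/
theorem sum_walk_compl_le (hr : 1 ≤ r) {hist : List (Multigraph n)}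
    (h : ∀ G ∈ hist, G.IsRegular r) (S : Finset (Fin n)) :
    ∑ v ∈ Sᶜ, ∑ w ∈ S, walk r hist v w ≤ ((Multigraph.sum hist).cutSize S : ℝ) / (2 * r) := by
  set f : Fin n → ℝ := fun w => if w ∈ S then 1 else 0 with hf
  have hf01 : ∀ v, f v ∈ Set.Icc (0 : ℝ) 1 := fun v => by
    simp only [hf]
    split_ifs <;> simp
  have e : ∀ v, ∑ w ∈ S, walk r hist v w = (walk r hist).mulVec f v := fun v => by
    simp [Matrix.mulVec, dotProduct, hf]
  simp only [e]
  clear e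
  induction hist using List.reverseRecOn with
  | nil =>
    have : ∑ v ∈ Sᶜ, f v = 0 := Finset.sum_eq_zero fun v hv => by
      simp [hf, Finset.mem_compl.1 hv]
    simp only [walk, List.foldl_nil, Matrix.one_mulVec, this]
    positivity
  | append_singleton hist G ih =>
    simp only [List.mem_append, List.mem_singleton] at h
    have h' : ∀ G ∈ hist, G.IsRegular r := fun G hG => h G (Or.inl hG)
    rw [walk_append, ← Matrix.mulVec_mulVec, cutSize_sum_append]
    have := sum_lazyWalk_compl_le hr (h G (Or.inr rfl)) S (walk_mulVec_mem_Icc hr h' hf01)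
    push_cast
    rw [add_div]
    linarith [ih h']

/-- No deviation exceeds `1 / (2 * n)`, so all walk entries are at least `1 / (2 * n)`. As the
complement of `S` has at least `n / 2` vertices, it receives mass at least `|S| / 4`, which is at
most `cutSize / (2 * r)`. -/
theorem expansion_of_potential_le (hn : 2 ≤ n) (hr : 1 ≤ r) {hist : List (Multigraph n)}
    (h : ∀ G ∈ hist, G.IsRegular r) (hpot : potential r hist ≤ 1 / (4 * (n : ℝ) ^ 2)) :
    (r : ℝ) / 2 ≤ (Multigraph.sum hist).expansion := by
  have hr0 : (0 : ℝ) < r := by positivity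
  have hn0 : (0 : ℝ) < n := by positivity
  have hentry : ∀ v j, 1 / (2 * (n : ℝ)) ≤ walk r hist v j := fun v j => by
    have h1 : dev r hist v j ^ 2 ≤ potential r hist :=
      (Finset.single_le_sum (f := fun j => dev r hist v j ^ 2) (fun _ _ => sq_nonneg _)
        (Finset.mem_univ j)).trans
      (Finset.single_le_sum (f := fun v => ∑ j, dev r hist v j ^ 2)
        (fun _ _ => Finset.sum_nonneg fun _ _ => sq_nonneg _) (Finset.mem_univ v))
    have h2 : dev r hist v j ^ 2 ≤ (1 / (2 * (n : ℝ))) ^ 2 := by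
      refine (h1.trans hpot).trans (le_of_eq ?_)
      field_simp
      norm_num
    have h3 := (abs_le_of_sq_le_sq' h2 (by positivity)).1
    unfold dev at h3
    have : 1 / (n : ℝ) = 1 / (2 * n) + 1 / (2 * n) := by field_simp; norm_num
    linarith
  have : Nonempty {S : Finset (Fin n) // S.Nonempty ∧ 2 * S.card ≤ n} :=
    ⟨⟨{⟨0, by omega⟩}, by simp, by simpa using hn⟩⟩
  refine le_ciInf fun ⟨S, hS, hcard⟩ => ?_
  have hS0 : (0 : ℝ) < S.card := by exact_mod_cast hS.card_pos
  rw [le_div_iff₀ hS0]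
  have h1 := sum_walk_compl_le hr h S
  have h2 : (Sᶜ.card : ℝ) * (S.card * (1 / (2 * (n : ℝ)))) ≤ ∑ v ∈ Sᶜ, ∑ w ∈ S, walk r hist v w := by
    calc _ = ∑ v ∈ Sᶜ, ∑ w ∈ S, 1 / (2 * (n : ℝ)) := by simp only [Finset.sum_const, nsmul_eq_mul]
      _ ≤ _ := Finset.sum_le_sum fun v _ => Finset.sum_le_sum fun w _ => hentry v w
  have h3 : (n : ℝ) / 2 ≤ Sᶜ.card := by
    have h4 : S.card + Sᶜ.card = n := by rw [Finset.card_add_card_compl, Fintype.card_fin]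
    have h5 : n ≤ 2 * Sᶜ.card := by omega
    have : (n : ℝ) ≤ 2 * Sᶜ.card := by exact_mod_cast h5
    linarith
  have h6 : (n : ℝ) / 2 * (S.card * (1 / (2 * (n : ℝ)))) ≤
      ((Multigraph.sum hist).cutSize S : ℝ) / (2 * r) :=
    (mul_le_mul_of_nonneg_right h3 (by positivity)).trans (h2.trans h1)
  rw [le_div_iff₀ (by positivity)] at h6
  refine le_trans (le_of_eq ?_) h6
  field_simp

/-! ### The game -/

theorem play_append (W : WeaveStrategy n) (bits : List (cutStrategy.Coins n r))
    (ρ : cutStrategy.Coins n r) :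
    (play cutStrategy r W (bits ++ [ρ])).2 = (play cutStrategy r W bits).2 ++
      [W (play cutStrategy r W bits).1
        (cutStrategy.cut r (play cutStrategy r W bits).2 ρ)] := by
  simp [play]

theorem play_isRegular {W : WeaveStrategy n} (hW : W.IsLegal r)
    (bits : List (cutStrategy.Coins n r)) :
    ∀ G ∈ (play cutStrategy r W bits).2, G.IsRegular r := by
  induction bits using List.reverseRecOn with
  | nil => simp [play]
  | append_singleton bits ρ ih =>
    intro G hG
    rw [play_append, List.mem_append, List.mem_singleton] at hG
    rcases hG with hG | rfl
    · exact ih G hG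
    · exact (hW _ _ (Or.inl (card_cut _ _))).1

/-- The expected potential after `T` rounds. -/
theorem sum_potential_play_le (hn : 2 ≤ n) (hr : 1 ≤ r) {W : WeaveStrategy n}
    (hW : W.IsLegal r) (T : ℕ) :
    ∑ ω : Fin T → cutStrategy.Coins n r, potential r (play cutStrategy r W (List.ofFn ω)).2 ≤
      (Fintype.card (Fin T → cutStrategy.Coins n r) : ℝ) *
        (Real.exp (-(T / (80 * r * Real.log n))) * n) := by
  induction T with
  | zero =>
    simpa [play] using potential_nil_le n r
  | succ T ih =>
    set N : ℝ := (Fintype.card (cutStrategy.Coins n r) : ℝ) with hN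
    have hN0 : 0 ≤ N := Nat.cast_nonneg _
    set δ : ℝ := 1 / (80 * r * Real.log n) with hδ
    have hcard : (Fintype.card (Fin (T + 1) → cutStrategy.Coins n r) : ℝ) =
        N * (Fintype.card (Fin T → cutStrategy.Coins n r) : ℝ) := by
      rw [Fintype.card_fun (α := Fin (T + 1)), Fintype.card_fun (α := Fin T), Fintype.card_fin,
        Fintype.card_fin, pow_succ, hN, mul_comm, Nat.cast_mul]
    have hexp : Real.exp (-((T + 1 : ℕ) / (80 * r * Real.log n))) =
        Real.exp (-δ) * Real.exp (-(T / (80 * r * Real.log n))) := by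
      rw [← Real.exp_add, hδ]
      push_cast
      ring_nf
    have hround : ∀ ω : Fin T → cutStrategy.Coins n r,
        ∑ ρ, potential r (play cutStrategy r W (List.ofFn ω ++ [ρ])).2 ≤
          N * Real.exp (-δ) * potential r (play cutStrategy r W (List.ofFn ω)).2 := fun ω => by
      simp only [play_append]
      -- For fixed earlier coins, the weave player's answer depends on the new coins through the
      -- cut. The one-round bound holds for every such family of answers, so adaptivity costs
      -- nothing.
      refine (sum_potential_append_le hn hr (play_isRegular hW _) _ fun ρ =>
        hW _ _ (Or.inl (card_cut _ _))).trans ?_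
      rw [mul_assoc N]
      have h1 := Real.add_one_le_exp (-δ)
      have h2 := potential_nonneg r (play cutStrategy r W (List.ofFn ω)).2
      exact mul_le_mul_of_nonneg_left
        (mul_le_mul_of_nonneg_right (by linarith) h2) hN0
    calc ∑ ω : Fin (T + 1) → cutStrategy.Coins n r,
          potential r (play cutStrategy r W (List.ofFn ω)).2
        = ∑ ω : Fin T → cutStrategy.Coins n r, ∑ ρ,
            potential r (play cutStrategy r W (List.ofFn ω ++ [ρ])).2 := by
          -- Splitting off the coins of the last round turns the average into an iterated one.
          rw [← (Fin.snocEquiv fun _ => cutStrategy.Coins n r).sum_comp, Fintype.sum_prod_type,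
            Finset.sum_comm]
          refine Finset.sum_congr rfl fun ω _ => Finset.sum_congr rfl fun ρ _ => ?_
          rw [List.ofFn_succ']
          simp [Fin.snocEquiv]
      _ ≤ ∑ ω : Fin T → cutStrategy.Coins n r,
            N * Real.exp (-δ) * potential r (play cutStrategy r W (List.ofFn ω)).2 :=
          Finset.sum_le_sum fun ω _ => hround ω
      _ ≤ N * Real.exp (-δ) * ((Fintype.card (Fin T → cutStrategy.Coins n r) : ℝ) *
            (Real.exp (-(T / (80 * r * Real.log n))) * n)) := by
          rw [← Finset.mul_sum]
          exact mul_le_mul_of_nonneg_left ih (by positivity)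
      _ = _ := by
          rw [hcard, hexp]
          ring

/-- Markov's inequality for the uniform distribution. -/
theorem uniformProb_ge {Ω : Type} [Fintype Ω] [Nonempty Ω] {E : Set Ω} {X : Ω → ℝ} {a b : ℝ}
    (ha : 0 < a) (hX : ∀ ω, 0 ≤ X ω) (hE : ∀ ω, X ω ≤ a → ω ∈ E)
    (hsum : ∑ ω, X ω ≤ (Fintype.card Ω : ℝ) * (a * b)) : 1 - b ≤ uniformProb E := by
  classical
  have hN : (0 : ℝ) < Fintype.card Ω := by exact_mod_cast Fintype.card_pos
  unfold uniformProb
  rw [le_div_iff₀ hN]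
  have h1 : (E.ncard : ℝ) + (Eᶜ.ncard : ℝ) = Fintype.card Ω := by
    rw [← Nat.card_eq_fintype_card]
    exact_mod_cast Set.ncard_add_ncard_compl E
  have h2 : a * (Eᶜ.ncard : ℝ) ≤ ∑ ω, X ω := by
    rw [Set.ncard_eq_toFinset_card', mul_comm]
    calc (Eᶜ.toFinset.card : ℝ) * a = ∑ ω ∈ Eᶜ.toFinset, a := by simp
      _ ≤ ∑ ω ∈ Eᶜ.toFinset, X ω := Finset.sum_le_sum fun ω hω => by
          by_contra hlt
          exact (Set.mem_toFinset.1 hω) (hE ω (not_le.1 hlt).le)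
      _ ≤ _ := Finset.sum_le_univ_sum_of_nonneg hX
  have h3 : (Eᶜ.ncard : ℝ) ≤ Fintype.card Ω * b := by
    refine le_of_mul_le_mul_left (h2.trans (hsum.trans (le_of_eq ?_))) ha
    ring
  linarith

/-- Since `480 = 6 * 80`, the decay is at least `n ^ (6 * k)`. This pays for the initial potential,
the Markov threshold and the failure probability because `4 ≤ n ^ 2` and `5 + k ≤ 6 * k`. -/
theorem exp_rounds_le (hn : 2 ≤ n) (hr : 1 ≤ r) {k T : ℕ} (hk : 1 ≤ k)
    (hT : 480 * (k : ℝ) * r * Real.log n ^ 2 ≤ T) :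
    Real.exp (-(T / (80 * r * Real.log n))) * n ≤
      1 / (4 * (n : ℝ) ^ 2) * (1 / (n : ℝ) ^ k) := by
  have hn' : (2 : ℝ) ≤ n := by exact_mod_cast hn
  have hr0 : (0 : ℝ) < r := by positivity
  have hlog : 0 < Real.log n := Real.log_pos (by linarith)
  have h1 : ((6 * k : ℕ) : ℝ) * Real.log n ≤ T / (80 * r * Real.log n) := by
    rw [le_div_iff₀ (by positivity)]
    refine le_trans (le_of_eq ?_) hT
    push_cast
    ring
  have h2 : Real.exp (-(T / (80 * r * Real.log n))) ≤ 1 / (n : ℝ) ^ (6 * k) := by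
    calc _ ≤ Real.exp (-(((6 * k : ℕ) : ℝ) * Real.log n)) := Real.exp_le_exp.2 (by linarith)
      _ = _ := by rw [Real.exp_neg, Real.exp_nat_mul, Real.exp_log (by linarith), one_div]
  have h3 : 4 * (n : ℝ) ^ 3 * (n : ℝ) ^ k ≤ (n : ℝ) ^ (6 * k) := by
    calc 4 * (n : ℝ) ^ 3 * (n : ℝ) ^ k ≤ (n : ℝ) ^ 2 * (n : ℝ) ^ 3 * (n : ℝ) ^ k := by
          gcongr
          nlinarith
      _ = (n : ℝ) ^ (5 + k) := by ring
      _ ≤ _ := pow_le_pow_right₀ (by linarith) (by omega)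
  calc _ ≤ 1 / (n : ℝ) ^ (6 * k) * n := by gcongr
    _ ≤ 1 / (4 * (n : ℝ) ^ 3 * (n : ℝ) ^ k) * n := by gcongr
    _ = _ := by field_simp

end CutWeave

open CutWeave in
theorem mainTheorem3 :
    ∃ A : CutStrategy, A.IsValid ∧ A.IsPolyTime ∧ A.IsWalkProjection ∧
      ∃ C : ℝ, 0 < C ∧ ∀ n r : ℕ, 2 ≤ n → 1 ≤ r →
        ∀ W : WeaveStrategy n, W.IsLegal r →
          ∀ k T : ℕ, 1 ≤ k → C * (k : ℝ) * (r : ℝ) * (Real.log (n : ℝ)) ^ 2 ≤ (T : ℝ) →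
            1 - 1 / (n : ℝ) ^ k ≤
              uniformProb {ω : Fin T → A.Coins n r |
                (finalGraph A r W ω).IsEdgeExpander ∧
                (r : ℝ) / 2 ≤ (finalGraph A r W ω).expansion} := by
  refine ⟨cutStrategy, cutStrategy_isValid, cutStrategy_isPolyTime, cutStrategy_isWalkProjection,
    480, by norm_num, fun n r hn hr W hW k T hk hT => ?_⟩
  refine uniformProb_ge (a := 1 / (4 * (n : ℝ) ^ 2)) (by positivity)
    (fun ω => potential_nonneg r (play cutStrategy r W (List.ofFn ω)).2) (fun ω hω => ?_)
    ((sum_potential_play_le hn hr hW T).trans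
      (mul_le_mul_of_nonneg_left (exp_rounds_le hn hr hk hT) (Nat.cast_nonneg _)))
  have hexp : (r : ℝ) / 2 ≤ (finalGraph cutStrategy r W ω).expansion :=
    expansion_of_potential_le hn hr (play_isRegular hW _) hω
  have hr' : (1 : ℝ) ≤ r := by exact_mod_cast hr
  -- As `r ≥ 1`, the bound `r / 2` already exceeds `1 / 3`.
  exact ⟨lt_of_lt_of_le (by linarith) hexp, hexp⟩
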